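/- Let $Q\ge 2$ and let $n,t$ be integers with $1<t<n\le 2t$. Let $\mathcal C\subseteq(\mathbb C^Q)^{\otimes n}$ be an $[[n,2t-n]]_Q$ quantum MDS code, that is, $\dim\mathcal C=Q^{2t-n}$ and $\mathcal C$ has a distance $D$ with $2(D-1)=n-(2t-n)$, i.e. $D=n-t+1$. (Distance $D$ means: for every operator $\Gamma$ acting on at most $D-1$ qudits there is a scalar $c(\Gamma)$ with $\langle\phi|\Gamma|\psi\rangle=c(\Gamma)\langle\phi|\psi\rangle$ for all $\phi,\psi\in\mathcal C$ if $\dim\mathcal C>1$, and $\langle\phi|\Gamma|\phi\rangle=Q^{-n}\operatorname{Tr}\Gamma$ for the unit vectors $\phi\in\mathcal C$ if $\dim\mathcal C=1$.) The $n$ qudits are stored in nodes $W_1,\dots,W_n$. Let $e\in[n]$, let $T\subseteq[n]\setminus\{e\}$ with $|T|=t$, let $j_1\in T$, and let $\widehat W_e$ be a replacement node. Let $H_2$ be the star network with edges $\{W_{j_1},\widehat W_e\}$ and $\{W_{j_1},W_j\}$ for $j\in T\setminus\{j_1\}$. An erasure correction protocol over a network $H$ is a finite sequence of local quantum operations and measurements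 (with arbitrary finite-dimensional ancillas) at the nodes $W_i$ ($i\ne e$) and $\widehat W_e$, with free classical communication of the outcomes among all these nodes, and of transfers of finite-dimensional quantum systems between the two ends of edges of $H$, each step possibly depending on earlier outcomes; nothing is applied to $W_e$. For every $|\phi\rangle\in\mathcal C$ it must transform, with probability $1$, the state $|\phi\rangle_{W_1\cdots W_n}|0\rangle_{\widehat W_e}$ into $|\phi\rangle_{W_1\cdots W_{e-1}\widehat W_eW_{e+1}\cdots W_n}|\epsilon\rangle_{W_e}$ for some pure state $|\epsilon\rangle\in\mathbb C^Q$, which may depend on the measurement outcomes. For $h\in H$ let $\beta_h$ be the product of the dimensions of the systems transferred along $h$ in either direction (the maximum over the measurement outcomes, if it depends on them). The entanglement cost is $$\mathrm{EC}_{e,T}(H)=\min_{\text{protocols}}\ \sum_{h\in H}\log_Q\beta_h .$$ Then the minimum over the protocols for $H_2$ exists, and $\mathrm{EC}_{e,T}(H_2)=2t-1$. -/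

import Mathlib

open scoped Matrix

/-! ## Quantum codes -/

/-- Vectors of `(ℂ^Q)^{⊗ n}`, as amplitude functions in the computational basis;
the inner product `⟨φ|ψ⟩` is `star φ ⬝ᵥ ψ`. -/
abbrev QuditVec (n Q : ℕ) : Type := (Fin n → Fin Q) → ℂ

/-- The operator `G ⊗ I` on `n` qudits, where `G` acts on the qudits in `S` and the
identity acts on the qudits outside `S`. -/
def extendOp {n Q : ℕ} (S : Finset (Fin n))
    (G : Matrix (S → Fin Q) (S → Fin Q) ℂ) :
    Matrix (Fin n → Fin Q) (Fin n → Fin Q) ℂ :=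
  Matrix.of fun x y =>
    if ∀ i, i ∉ S → x i = y i then G (fun i => x i) (fun i => y i) else 0

/-- The code `C` has distance `D`: for all operators `Γ` acting on at most `D - 1` qudits,
`⟨φ|Γ|ψ⟩ = c(Γ) ⟨φ|ψ⟩` for all `φ, ψ` in the code if the code has dimension `> 1`, and
`⟨φ|Γ|φ⟩ = Q^{-n} Tr Γ` for the unit vectors `φ` of the code if it has dimension `1`. -/
def HasDistance {n Q : ℕ} (C : Submodule ℂ (QuditVec n Q)) (D : ℕ) : Prop :=
  ∀ S : Finset (Fin n), S.card < D → ∀ G : Matrix (S → Fin Q) (S → Fin Q) ℂ,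
    (1 < Module.finrank ℂ C →
      ∃ c : ℂ, ∀ φ ∈ C, ∀ ψ ∈ C,
        star φ ⬝ᵥ (extendOp S G *ᵥ ψ) = c * (star φ ⬝ᵥ ψ)) ∧
    (Module.finrank ℂ C = 1 →
      ∀ φ ∈ C, star φ ⬝ᵥ φ = 1 →
        star φ ⬝ᵥ (extendOp S G *ᵥ φ) = ((Q : ℂ) ^ n)⁻¹ * (extendOp S G).trace)

/-- `C` is an `[[n,k]]_Q` quantum MDS code: it has dimension `Q ^ k` and a distance `D`
with equality in the quantum Singleton bound, `2 (D - 1) = n - k`. -/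
def IsQMDS {n Q : ℕ} (C : Submodule ℂ (QuditVec n Q)) (k : ℕ) : Prop :=
  Module.finrank ℂ C = Q ^ k ∧
    ∃ D : ℕ, HasDistance C D ∧ 2 * ((D : ℤ) - 1) = (n : ℤ) - (k : ℤ)

/-! ## Distributed protocols -/

/-- The nodes: `some i` is the node storing the `i`-th physical qudit and `none` is the
replacement node. -/
abbrev Node (n : ℕ) : Type := Option (Fin n)

/-- Joint (unnormalised) pure states of all nodes. When node `p` holds a system of
dimension `d p`, only the amplitudes at the `x` with `x p < d p` for all `p` matter
(the others are `0`). -/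
abbrev NetState (n : ℕ) : Type := (Node n → ℕ) → ℂ

/-- Apply the operator `K : ℂ^a → ℂ^b` to the system of node `p`. -/
def applyLocal {n a b : ℕ} (p : Node n) (K : Matrix (Fin b) (Fin a) ℂ)
    (ψ : NetState n) : NetState n :=
  fun x => if h : x p < b then
    ∑ i : Fin a, K ⟨x p, h⟩ i * ψ (Function.update x p (i : ℕ)) else 0

/-- Transfer of a system of dimension `η` from node `A` to node `B`: the system
`ℂ^{r η} = ℂ^r ⊗ ℂ^η` of `A` has basis `|u η + s⟩ = |u⟩|s⟩`, and
`|u η + s⟩_A |v⟩_B` becomes `|u⟩_A |v η + s⟩_B`. -/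
def applySend {n : ℕ} (A B : Node n) (η : ℕ) (ψ : NetState n) : NetState n :=
  fun x => ψ (Function.update (Function.update x A (x A * η + x B % η)) B (x B / η))

/-- Finite protocols with free classical communication, in which quantum systems are
transferred only along the edges in `H`, and the erased node `e` takes no part.
`Protocol e H d` is the type of the protocols that start when node `p` holds a system of
dimension `d p`. A protocol either stops; or some node `p` performs a measurement
with finitely many outcomes `o`, given by Kraus operators `K o` (which includes unitaries,
adding and discarding ancillas), and announces the outcome to all the nodes, everything
that follows depending on it; or a system of dimension `η` is transferred along an edge. -/
inductive Protocol {n : ℕ} (e : Fin n) (H : Finset (Sym2 (Node n))) :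
    (Node n → ℕ) → Type
  | halt (d : Node n → ℕ) : Protocol e H d
  | localOp (d : Node n → ℕ) (p : Node n) (hp : p ≠ some e) (m : ℕ) (k : Fin m → ℕ)
      (hk : ∀ o, 0 < k o) (K : (o : Fin m) → Matrix (Fin (k o)) (Fin (d p)) ℂ)
      (hK : ∑ o, (K o)ᴴ * K o = 1)
      (next : (o : Fin m) → Protocol e H (Function.update d p (k o))) : Protocol e H d
  | send (d : Node n → ℕ) (A B : Node n) (hA : A ≠ some e) (hB : B ≠ some e)
      (hAB : A ≠ B) (hH : s(A, B) ∈ H) (r η : ℕ) (hd : d A = r * η)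
      (next : Protocol e H (Function.update (Function.update d A r) B (d B * η))) :
      Protocol e H d

namespace Protocol

/-- Whatever the measurement outcomes are, the protocol run on `ψ` stops with dimensions
`d'` and an (unnormalised) state `ψ'` such that `R d' ψ'`. The squared norm of `ψ'` is the
probability of the outcomes times that of `ψ`. -/
def AlwaysEnds {n : ℕ} {e : Fin n} {H : Finset (Sym2 (Node n))}
    (R : (Node n → ℕ) → NetState n → Prop) :
    {d : Node n → ℕ} → Protocol e H d → NetState n → Prop
  | _, halt d, ψ => R d ψ
  | _, localOp _ p _ _ _ _ K _ next, ψ =>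
      ∀ o, (next o).AlwaysEnds R (applyLocal p (K o) ψ)
  | _, send _ A B _ _ _ _ _ η _ next, ψ => next.AlwaysEnds R (applySend A B η ψ)

/-- `β_h`: the product of the dimensions of the systems transferred along the edge `h`, in
either direction (the largest value over the measurement outcomes if it depends on them). -/
def beta {n : ℕ} {e : Fin n} {H : Finset (Sym2 (Node n))} :
    {d : Node n → ℕ} → Protocol e H d → Sym2 (Node n) → ℕ
  | _, halt _, _ => 1
  | _, localOp _ _ _ _ _ _ _ _ next, h => Finset.univ.sup fun o => (next o).beta h
  | _, send _ A B _ _ _ _ _ η _ next, h =>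
      (if h = s(A, B) then η else 1) * next.beta h

end Protocol

/-- The amplitudes at `x` of a vector of `n` qudits of dimension `Q`, and `0` at other
values of `x`. -/
def toAmp {n Q : ℕ} (φ : QuditVec n Q) (x : Fin n → ℕ) : ℂ :=
  if h : ∀ i, x i < Q then φ (fun i => ⟨x i, h i⟩) else 0

/-- The state `|φ⟩_{W_1 … W_n} |0⟩_{Ŵ}`, where `Ŵ` is the replacement node. -/
def initialState {n Q : ℕ} (φ : QuditVec n Q) : NetState n :=
  fun x => if x none = 0 then toAmp φ (fun i => x (some i)) else 0

/-- The state `|φ⟩_{W_1 … W_{e-1} Ŵ W_{e+1} … W_n} |ε⟩_{W_e}`. -/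
def correctedState {n Q : ℕ} (e : Fin n) (φ : QuditVec n Q) (ε : Fin Q → ℂ) :
    NetState n :=
  fun x => if h : x (some e) < Q then
    toAmp φ (Function.update (fun i => x (some i)) e (x none)) * ε ⟨x (some e), h⟩ else 0

/-- The protocol corrects the erasure of node `e` with certainty: for all logical states
`φ` and all measurement outcomes, it ends in `φ`, with the replacement node in the place of
node `e`, tensor some pure state of the erased qudit. The latter may depend on the outcomes,
and it is unnormalised (`0` for outcomes of probability `0`). -/
def CorrectsErasure {n Q : ℕ} (C : Submodule ℂ (QuditVec n Q)) (e : Fin n)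
    {H : Finset (Sym2 (Node n))} (P : Protocol e H (fun _ => Q)) : Prop :=
  ∀ φ ∈ C, P.AlwaysEnds
    (fun d ψ => d = (fun _ => Q) ∧ ∃ ε : Fin Q → ℂ, ψ = correctedState e φ ε)
    (initialState φ)

/-- The entanglement cost of correcting the erasure of node `e` over the network `H` is `c`:
`c` is the minimum of `∑ h ∈ H, log_Q β_h` over all erasure correction protocols. -/
def IsEntanglementCost {n Q : ℕ} (C : Submodule ℂ (QuditVec n Q)) (e : Fin n)
    (H : Finset (Sym2 (Node n))) (c : ℝ) : Prop :=
  IsLeast {w : ℝ | ∃ P : Protocol e H (fun _ => Q), CorrectsErasure C e P ∧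
    w = ∑ h ∈ H, Real.logb (Q : ℝ) (P.beta h : ℝ)} c

/-- The star network on the helper nodes `T` and the replacement node whose hub is the
helper node `j₁`. -/
def starAtHelper {n : ℕ} (T : Finset (Fin n)) (j₁ : Fin n) : Finset (Sym2 (Node n)) :=
  insert s(some j₁, none) ((T.erase j₁).image fun j => s(some j₁, some j))

section PartialInner

variable {n Q : ℕ}

theorem piecewise_piecewise_swap (S : Finset (Fin n)) (x y : Fin n → Fin Q) :
    S.piecewise (S.piecewise x y) (S.piecewise y x) = x := by
  ext i; by_cases h : i ∈ S <;> simp [h]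

/-- Exchanging the coordinates outside `S` of two configurations permutes the pairs. -/
theorem sum_sum_piecewise_swap {M : Type*} [AddCommMonoid M] (S : Finset (Fin n))
    (F : (Fin n → Fin Q) → (Fin n → Fin Q) → M) :
    ∑ x, ∑ y, F (S.piecewise x y) (S.piecewise y x) = ∑ x, ∑ y, F x y := by
  have hinv : Function.Involutive
      (fun p : (Fin n → Fin Q) × (Fin n → Fin Q) =>
        (S.piecewise p.1 p.2, S.piecewise p.2 p.1)) := by
    rintro ⟨x, y⟩
    simp only [piecewise_piecewise_swap]
  have := Equiv.sum_comp hinv.toPerm (fun p => F p.1 p.2)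
  simpa [Fintype.sum_prod_type] using this

theorem card_config : Fintype.card (Fin n → Fin Q) = Q ^ n := by simp

theorem sum_sum_piecewise (S : Finset (Fin n)) (f : (Fin n → Fin Q) → ℂ) :
    ∑ x, ∑ y, f (S.piecewise x y) = (Q : ℂ) ^ n * ∑ x, f x := by
  rw [sum_sum_piecewise_swap S (fun x _ => f x)]
  simp [Finset.mul_sum]

theorem card_agree_off (S : Finset (Fin n)) (u : Fin n → Fin Q) :
    (Finset.univ.filter fun z : Fin n → Fin Q => ∀ i, i ∉ S → z i = u i).card
      = Q ^ S.card := by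
  have : (Finset.univ.filter fun z : Fin n → Fin Q => ∀ i, i ∉ S → z i = u i)
      = Fintype.piFinset (fun i => if i ∈ S then Finset.univ else {u i}) := by
    ext z
    simp only [Finset.mem_filter, Finset.mem_univ, true_and, Fintype.mem_piFinset]
    refine forall_congr' fun i => ?_
    by_cases h : i ∈ S <;> simp [h]
  rw [this, Fintype.card_piFinset]
  have : ∀ i, (if i ∈ S then (Finset.univ : Finset (Fin Q)) else {u i}).card
      = if i ∈ S then Q else 1 := by
    intro i; split_ifs <;> simp
  simp [this]

theorem sum_piecewise_eq (S : Finset (Fin n)) (x : Fin n → Fin Q)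
    (f : (Fin n → Fin Q) → ℂ) :
    ∑ z, f (S.piecewise x z)
      = (Q : ℂ) ^ S.card * ∑ u, if ∀ i ∈ S, u i = x i then f u else 0 := by
  have h1 : ∀ z, f (S.piecewise x z) = ∑ u, if u = S.piecewise x z then f u else 0 := by
    intro z; simp
  simp_rw [h1]
  rw [Finset.sum_comm, Finset.mul_sum]
  refine Finset.sum_congr rfl fun u _ => ?_
  split_ifs with h
  · have h2 : ∀ z : Fin n → Fin Q, u = S.piecewise x z ↔ ∀ i, i ∉ S → z i = u i := by
      intro z
      constructor
      · intro hu i hi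
        rw [hu]; simp [hi]
      · intro hz
        ext i
        by_cases hi : i ∈ S
        · simp [hi, h i hi]
        · simp [hi, hz i hi]
    simp_rw [h2]
    rw [← Finset.sum_filter, Finset.sum_const, card_agree_off]
    simp
  · rw [mul_zero]
    refine Finset.sum_eq_zero fun z _ => if_neg ?_
    rintro rfl
    exact h fun i hi => by simp [hi]

/-- The matrix element between `x` and `x'` of the partial inner product of `φ` and `ψ` over
the qudits outside `S`, scaled by `Q ^ #S`. -/
def partialInner (S : Finset (Fin n)) (φ ψ : QuditVec n Q) (x x' : Fin n → Fin Q) : ℂ :=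
  ∑ z, star (φ (S.piecewise x z)) * ψ (S.piecewise x' z)

theorem piecewise_congr_left {S : Finset (Fin n)} {x y : Fin n → Fin Q}
    (h : ∀ i ∈ S, x i = y i) (z : Fin n → Fin Q) : S.piecewise x z = S.piecewise y z := by
  ext i
  by_cases hi : i ∈ S
  · simp [hi, h i hi]
  · simp [hi]

theorem partialInner_congr {S : Finset (Fin n)} (φ ψ : QuditVec n Q)
    {x x' y y' : Fin n → Fin Q} (h : ∀ i ∈ S, x i = y i) (h' : ∀ i ∈ S, x' i = y' i) :
    partialInner S φ ψ x x' = partialInner S φ ψ y y' := by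
  unfold partialInner
  simp_rw [piecewise_congr_left h, piecewise_congr_left h']

theorem star_partialInner (S : Finset (Fin n)) (φ ψ : QuditVec n Q) (x x' : Fin n → Fin Q) :
    star (partialInner S φ ψ x x') = partialInner S ψ φ x' x := by
  unfold partialInner
  rw [star_sum]
  exact Finset.sum_congr rfl fun z _ => by rw [star_mul, star_star]

theorem sum_partialInner_piecewise {S T : Finset (Fin n)} (hST : S ⊆ T) (φ ψ : QuditVec n Q)
    (x x' : Fin n → Fin Q) :
    ∑ w, partialInner T φ ψ (S.piecewise x w) (S.piecewise x' w)
      = (Q : ℂ) ^ n * partialInner S φ ψ x x' := by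
  unfold partialInner
  rw [← sum_sum_piecewise T (fun z => star (φ (S.piecewise x z)) * ψ (S.piecewise x' z))]
  have h : ∀ x w z : Fin n → Fin Q,
      T.piecewise (S.piecewise x w) z = S.piecewise x (T.piecewise w z) := by
    intro x w z
    ext i
    by_cases hi : i ∈ S
    · simp [hi, hST hi]
    · by_cases hT : i ∈ T <;> simp [hi, hT]
  simp_rw [h]

end PartialInner

section HilbertSchmidt

variable {n Q : ℕ} {R : Type*} [Fintype R] [DecidableEq R]

/-- If the qudits outside `T` are decoupled from the index `r`, the reduced states of `T`
and of its complement have the same purity. -/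
theorem sum_sum_normSq_marginal (a : R → QuditVec n Q) (T : Finset (Fin n))
    (κ : (Fin n → Fin Q) → (Fin n → Fin Q) → ℂ)
    (hκ : ∀ r r' x x', partialInner Tᶜ (a r) (a r') x x' = if r = r' then κ x x' else 0) :
    ∑ x, ∑ x', (∑ r, partialInner T (a r) (a r) x x')
        * star (∑ r, partialInner T (a r) (a r) x x')
      = Fintype.card R * ∑ x, ∑ x', κ x x' * star (κ x x') := by
  set M : Matrix (R × (Fin n → Fin Q)) (Fin n → Fin Q) ℂ :=
    Matrix.of fun q x => a q.1 (T.piecewise x q.2) with hM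
  have h1 : ∀ x x', ∑ r, partialInner T (a r) (a r) x x' = (Mᴴ * M) x x' := by
    intro x x'
    simp [partialInner, Matrix.mul_apply, Fintype.sum_prod_type, hM]
  have h2 : ∀ q q', (M * Mᴴ) q q' = if q'.1 = q.1 then κ q'.2 q.2 else 0 := by
    intro q q'
    rw [← hκ]
    simp only [hM, partialInner, Matrix.mul_apply, Matrix.of_apply,
      Matrix.conjTranspose_apply, Finset.piecewise_compl]
    exact Finset.sum_congr rfl fun z _ => mul_comm _ _
  have hκs : ∀ r : R, ∀ x x', star (κ x x') = κ x' x := by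
    intro r x x'
    have e1 := hκ r r x x'
    have e2 := hκ r r x' x
    simp only [if_true] at e1 e2
    rw [← e1, ← e2, star_partialInner]
  have h3 : ∑ x, ∑ x', (Mᴴ * M) x x' * star ((Mᴴ * M) x x')
      = Matrix.trace ((Mᴴ * M) * (Mᴴ * M)) := by
    simp only [Matrix.trace, Matrix.diag]
    refine Finset.sum_congr rfl fun x _ => ?_
    rw [Matrix.mul_apply (M := Mᴴ * M)]
    refine Finset.sum_congr rfl fun x' _ => ?_
    rw [← Matrix.conjTranspose_apply, Matrix.conjTranspose_mul,
      Matrix.conjTranspose_conjTranspose]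
  have h4 : Matrix.trace ((Mᴴ * M) * (Mᴴ * M)) = Matrix.trace ((M * Mᴴ) * (M * Mᴴ)) := by
    rw [Matrix.mul_assoc, Matrix.trace_mul_comm]
    simp only [Matrix.mul_assoc]
  simp_rw [h1]
  rw [h3, h4]
  simp only [Matrix.trace, Matrix.diag, Matrix.mul_apply (M := M * Mᴴ), h2,
    Fintype.sum_prod_type]
  have h5 : ∀ (r : R) (z : Fin n → Fin Q), (∑ r' : R, ∑ z' : Fin n → Fin Q,
      (if r' = r then κ z' z else 0) * (if r = r' then κ z z' else 0))
      = ∑ z', κ z z' * star (κ z z') := by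
    intro r z
    rw [Finset.sum_eq_single r]
    · refine Finset.sum_congr rfl fun z' _ => ?_
      simp [hκs r, mul_comm]
    · intro r' _ hr'
      simp [hr']
    · simp
  simp_rw [h5]
  simp

theorem hilbertSchmidt_dist_marginal (a : R → QuditVec n Q) (hQ : 0 < Q) (S T : Finset (Fin n))
    (hST : S ⊆ T) (hR : Fintype.card R = Q ^ (T \ S).card)
    (κ κ' : (Fin n → Fin Q) → (Fin n → Fin Q) → ℂ)
    (hκ : ∀ r r' x x', partialInner Tᶜ (a r) (a r') x x' = if r = r' then κ x x' else 0)
    (hκ' : ∀ r r' x x', partialInner S (a r) (a r') x x' = if r = r' then κ' x x' else 0) :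
    ∑ x, ∑ x', Complex.normSq ((∑ r, partialInner T (a r) (a r) x x')
        - Q ^ (T \ S).card * if ∀ i ∈ T \ S, x' i = x i then κ' x x' else 0)
      = Q ^ (T \ S).card * ((∑ x, ∑ x', Complex.normSq (κ x x'))
        - ∑ x, ∑ x', Complex.normSq (κ' x x')) := by
  set E := T \ S with hE
  set q : ℂ := (Q : ℂ) ^ E.card with hq
  have hq0 : q ≠ 0 := by
    rw [hq]; exact pow_ne_zero _ (by exact_mod_cast hQ.ne')
  have hqs : star q = q := by simp [hq]
  have hN0 : (Q : ℂ) ^ n ≠ 0 := pow_ne_zero _ (by exact_mod_cast hQ.ne')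
  obtain ⟨r0⟩ : Nonempty R := by
    rw [← Fintype.card_pos_iff, hR]; positivity
  have hκ'e : ∀ x x', κ' x x' = partialInner S (a r0) (a r0) x x' := by
    intro x x'; rw [hκ']; simp
  have hSE : ∀ {i}, i ∈ S → i ∉ E := by
    intro i hi; simp [hE, hi]
  have hκ'c : ∀ x x' y y' : Fin n → Fin Q, (∀ i ∈ S, x i = y i) → (∀ i ∈ S, x' i = y' i) →
      κ' x x' = κ' y y' := by
    intro x x' y y' h h'
    rw [hκ'e, hκ'e, partialInner_congr _ _ h h']
  set ρ : (Fin n → Fin Q) → (Fin n → Fin Q) → ℂ :=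
    fun x x' => ∑ r, partialInner T (a r) (a r) x x' with hρ
  set τ : (Fin n → Fin Q) → (Fin n → Fin Q) → ℂ :=
    fun x x' => if ∀ i ∈ E, x' i = x i then κ' x x' else 0 with hτ
  have hA := sum_sum_normSq_marginal a T κ hκ
  -- sums over configurations agreeing on `E`
  have hbox : ∀ x, ∀ f : (Fin n → Fin Q) → ℂ,
      ∑ x', (if ∀ i ∈ E, x' i = x i then f x' else 0) = q⁻¹ * ∑ y, f (E.piecewise x y) := by
    intro x f
    rw [sum_piecewise_eq, ← mul_assoc, inv_mul_cancel₀ hq0, one_mul]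
  have havg : ∀ x y, ∑ w, ρ (E.piecewise w x) (E.piecewise w y) = (Q : ℂ) ^ n * (q * κ' x y) := by
    intro x y
    simp only [hρ]
    rw [Finset.sum_comm]
    have : ∀ r, ∑ w, partialInner T (a r) (a r) (E.piecewise w x) (E.piecewise w y)
        = (Q : ℂ) ^ n * κ' x y := by
      intro r
      have h := sum_partialInner_piecewise hST (a r) (a r) x y
      rw [hκ' r r x y, if_pos rfl] at h
      rw [← h]
      have h' : ∀ x w : Fin n → Fin Q, ∀ i ∈ T, E.piecewise w x i = S.piecewise x w i := by
        intro x w i hi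
        by_cases hS : i ∈ S
        · simp [hS, hSE hS]
        · have : i ∈ E := by simp [hE, hi, hS]
          simp [hS, this]
      exact Finset.sum_congr rfl fun w _ => partialInner_congr _ _ (h' x w) (h' y w)
    simp_rw [this]
    simp [hR, hq]
    ring
  have hB : ∑ x, ∑ x', ρ x x' * star (τ x x') = ∑ x, ∑ x', κ' x x' * star (κ' x x') := by
    have e1 : ∀ x, ∑ x', ρ x x' * star (τ x x')
        = q⁻¹ * ∑ y, ρ x (E.piecewise x y) * star (κ' x y) := by
      intro x
      have : ∀ x', ρ x x' * star (τ x x')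
          = if ∀ i ∈ E, x' i = x i then ρ x x' * star (κ' x x') else 0 := by
        intro x'
        simp only [hτ]
        split_ifs <;> simp
      simp_rw [this]
      rw [hbox]
      congr 1
      refine Finset.sum_congr rfl fun y _ => ?_
      rw [hκ'c x (E.piecewise x y) x y (fun _ _ => rfl) (fun i hi => by simp [hSE hi])]
    simp_rw [e1]
    rw [← Finset.mul_sum, Finset.sum_comm]
    have e2 : ∀ y, ∑ x, ρ x (E.piecewise x y) * star (κ' x y)
        = q * ∑ x, κ' x y * star (κ' x y) := by
      intro y
      have e3 : (Q : ℂ) ^ n * ∑ x, ρ x (E.piecewise x y) * star (κ' x y)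
          = (Q : ℂ) ^ n * (q * ∑ x, κ' x y * star (κ' x y)) := by
        rw [← sum_sum_piecewise E, Finset.sum_comm]
        rw [Finset.mul_sum, Finset.mul_sum]
        refine Finset.sum_congr rfl fun x _ => ?_
        have : ∀ w, ρ (E.piecewise w x) (E.piecewise (E.piecewise w x) y)
            * star (κ' (E.piecewise w x) y)
            = ρ (E.piecewise w x) (E.piecewise w y) * star (κ' x y) := by
          intro w
          rw [hκ'c (E.piecewise w x) y x y (fun i hi => by simp [hSE hi]) (fun _ _ => rfl)]
          congr 2
          exact piecewise_congr_left (fun i hi => by simp [hi]) y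
        simp_rw [this]
        rw [← Finset.sum_mul, havg]
        ring
      exact mul_left_cancel₀ hN0 e3
    simp_rw [e2]
    rw [← Finset.mul_sum, ← mul_assoc, inv_mul_cancel₀ hq0, one_mul, Finset.sum_comm]
  have hC : ∑ x, ∑ x', τ x x' * star (τ x x')
      = q⁻¹ * ∑ x, ∑ x', κ' x x' * star (κ' x x') := by
    rw [Finset.mul_sum]
    refine Finset.sum_congr rfl fun x _ => ?_
    have : ∀ x', τ x x' * star (τ x x')
        = if ∀ i ∈ E, x' i = x i then κ' x x' * star (κ' x x') else 0 := by
      intro x'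
      simp only [hτ]
      split_ifs <;> simp
    simp_rw [this]
    rw [hbox]
    congr 1
    refine Finset.sum_congr rfl fun y _ => ?_
    rw [hκ'c x (E.piecewise x y) x y (fun _ _ => rfl) (fun i hi => by simp [hSE hi])]
  have hB' : ∑ x, ∑ x', τ x x' * star (ρ x x') = ∑ x, ∑ x', κ' x x' * star (κ' x x') := by
    have := congrArg star hB
    simpa [mul_comm] using this
  have key : ∑ x, ∑ x', (ρ x x' - q * τ x x') * star (ρ x x' - q * τ x x')
      = q * ((∑ x, ∑ x', κ x x' * star (κ x x')) - ∑ x, ∑ x', κ' x x' * star (κ' x x')) := by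
    have : ∀ x x', (ρ x x' - q * τ x x') * star (ρ x x' - q * τ x x')
        = ρ x x' * star (ρ x x') - q * (ρ x x' * star (τ x x')) - q * (τ x x' * star (ρ x x'))
          + q * q * (τ x x' * star (τ x x')) := by
      intro x x'
      rw [star_sub, star_mul, hqs]; ring
    simp_rw [this, Finset.sum_add_distrib, Finset.sum_sub_distrib, ← Finset.mul_sum]
    rw [hB, hB', hC, hA, hR]
    push_cast
    rw [← hq]
    field_simp
    ring
  have cast : ∀ f : (Fin n → Fin Q) → (Fin n → Fin Q) → ℂ,
      ∑ x, ∑ x', f x x' * star (f x x') = ((∑ x, ∑ x', Complex.normSq (f x x') : ℝ) : ℂ) := by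
    intro f
    push_cast
    simp_rw [Complex.normSq_eq_conj_mul_self]
    exact Finset.sum_congr rfl fun x _ => Finset.sum_congr rfl fun x' _ => mul_comm _ _
  rw [cast (fun x x' => ρ x x' - q * τ x x'), cast, cast] at key
  have key2 : ((∑ x, ∑ x', Complex.normSq (ρ x x' - q * τ x x') : ℝ) : ℂ)
      = (((Q : ℝ) ^ E.card * ((∑ x, ∑ x', Complex.normSq (κ x x'))
        - ∑ x, ∑ x', Complex.normSq (κ' x x')) : ℝ) : ℂ) := by
    rw [key]; push_cast; rfl
  exact Complex.ofReal_injective key2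

end HilbertSchmidt

section Decoupling

variable {n Q : ℕ} {R : Type*} [Fintype R] [DecidableEq R]

theorem sum_partialInner_eq_of_decoupled (a : R → QuditVec n Q) (hQ : 0 < Q) (m : ℕ)
    (κ : Finset (Fin n) → (Fin n → Fin Q) → (Fin n → Fin Q) → ℂ)
    (hκ : ∀ S : Finset (Fin n), S.card = m → ∀ r r' x x',
      partialInner S (a r) (a r') x x' = if r = r' then κ S x x' else 0)
    {S T : Finset (Fin n)} (hST : S ⊆ T) (hS : S.card = m) (hT : T.card + m = n)
    (hR : Fintype.card R = Q ^ (T.card - m)) (x x' : Fin n → Fin Q) :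
    ∑ r, partialInner T (a r) (a r) x x'
      = Q ^ (T.card - m) * if ∀ i ∈ T \ S, x' i = x i then κ S x x' else 0 := by
  have hTc : Tᶜ.card = m := by rw [Finset.card_compl, Fintype.card_fin]; omega
  have hSc : Sᶜ.card = T.card := by rw [Finset.card_compl, Fintype.card_fin]; omega
  have hsub : Tᶜ ⊆ Sᶜ := Finset.compl_subset_compl.mpr hST
  have hd : (T \ S).card = T.card - m := by rw [Finset.card_sdiff_of_subset hST, hS]
  have hd' : (Sᶜ \ Tᶜ).card = T.card - m := by
    rw [Finset.card_sdiff_of_subset hsub, hSc, hTc]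
  have h1 := hilbertSchmidt_dist_marginal a hQ S T hST (by rw [hd, hR]) (κ Tᶜ) (κ S)
    (hκ _ hTc) (hκ _ hS)
  have h2 := hilbertSchmidt_dist_marginal a hQ Tᶜ Sᶜ hsub (by rw [hd', hR]) (κ S) (κ Tᶜ)
    (by rw [compl_compl]; exact hκ _ hS) (hκ _ hTc)
  have hq : (0 : ℝ) < (Q : ℝ) ^ (T.card - m) := by positivity
  have hnn : ∀ f : (Fin n → Fin Q) → (Fin n → Fin Q) → ℂ,
      0 ≤ ∑ x, ∑ x', Complex.normSq (f x x') := fun f =>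
    Finset.sum_nonneg fun _ _ => Finset.sum_nonneg fun _ _ => Complex.normSq_nonneg _
  rw [hd] at h1
  rw [hd'] at h2
  have h2' := (hnn _).trans_eq h2
  have h2'' := nonneg_of_mul_nonneg_right h2' hq
  have h0 := hnn fun x x' => (∑ r, partialInner T (a r) (a r) x x')
        - Q ^ (T.card - m) * if ∀ i ∈ T \ S, x' i = x i then κ S x x' else 0
  have h3 : ∑ x, ∑ x', Complex.normSq ((∑ r, partialInner T (a r) (a r) x x')
        - Q ^ (T.card - m) * if ∀ i ∈ T \ S, x' i = x i then κ S x x' else 0) = 0 := by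
    refine le_antisymm ?_ h0
    rw [h1]
    exact mul_nonpos_of_nonneg_of_nonpos hq.le (by linarith)
  rw [Finset.sum_eq_zero_iff_of_nonneg
    (fun _ _ => Finset.sum_nonneg fun _ _ => Complex.normSq_nonneg _)] at h3
  have h4 := h3 x (Finset.mem_univ _)
  rw [Finset.sum_eq_zero_iff_of_nonneg (fun _ _ => Complex.normSq_nonneg _)] at h4
  exact sub_eq_zero.mp (Complex.normSq_eq_zero.mp (h4 x' (Finset.mem_univ _)))

theorem sum_partialInner_self (S : Finset (Fin n)) (φ : QuditVec n Q) :
    ∑ x, partialInner S φ φ x x = (Q : ℂ) ^ n * (star φ ⬝ᵥ φ) := by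
  unfold partialInner
  rw [sum_sum_piecewise S (fun u => star (φ u) * φ u)]
  rfl

/-- Quantum codes with parameters on the Singleton bound are pure. -/
theorem partialInner_eq_of_decoupled (a : R → QuditVec n Q) (hQ : 0 < Q) (m t : ℕ)
    (ht : t + m = n) (hmt : m < t)
    (κ : Finset (Fin n) → (Fin n → Fin Q) → (Fin n → Fin Q) → ℂ)
    (hκ : ∀ S : Finset (Fin n), S.card = m → ∀ r r' x x',
      partialInner S (a r) (a r') x x' = if r = r' then κ S x x' else 0)
    (hR : Fintype.card R = Q ^ (t - m)) (ha : ∀ r, star (a r) ⬝ᵥ a r = 1)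
    {S : Finset (Fin n)} (hS : S.card = m) (x x' : Fin n → Fin Q) :
    κ S x x' = if ∀ i ∈ S, x i = x' i then 1 else 0 := by
  obtain ⟨r0⟩ : Nonempty R := by
    rw [← Fintype.card_pos_iff, hR]; positivity
  have hκe : ∀ S : Finset (Fin n), S.card = m → ∀ x x',
      κ S x x' = partialInner S (a r0) (a r0) x x' := by
    intro S hS x x'; rw [hκ S hS]; simp
  have hκc : ∀ S : Finset (Fin n), S.card = m → ∀ x x' y y' : Fin n → Fin Q,
      (∀ i ∈ S, x i = y i) → (∀ i ∈ S, x' i = y' i) → κ S x x' = κ S y y' := by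
    intro S hS x x' y y' h h'
    rw [hκe S hS, hκe S hS, partialInner_congr _ _ h h']
  have hN0 : (Q : ℂ) ^ n ≠ 0 := pow_ne_zero _ (by exact_mod_cast hQ.ne')
  have hq0 : (Q : ℂ) ^ (t - m) ≠ 0 := pow_ne_zero _ (by exact_mod_cast hQ.ne')
  have key : ∀ i ∈ S, ∃ S' T : Finset (Fin n), S'.card = m ∧ i ∉ S' ∧ i ∈ T ∧
      ∀ x x', (Q : ℂ) ^ n * κ S x x' = ∑ w, if ∀ j ∈ T \ S',
        S.piecewise x' w j = S.piecewise x w j then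
          κ S' (S.piecewise x w) (S.piecewise x' w) else 0 := by
    intro i hi
    obtain ⟨T, hST, -, hT⟩ := Finset.exists_subsuperset_card_eq (Finset.subset_univ S)
      (n := t) (by omega) (by simp; omega)
    obtain ⟨S', hS'T, hS'⟩ := Finset.exists_subset_card_eq (s := T.erase i) (n := m)
      (by rw [Finset.card_erase_of_mem (hST hi)]; omega)
    refine ⟨S', T, hS', fun h => by simpa using hS'T h, hST hi, fun x x' => ?_⟩
    have h := fun w => sum_partialInner_eq_of_decoupled a hQ m κ hκ
      (hS'T.trans (Finset.erase_subset _ _)) hS' (by omega) (by rw [hT, hR])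
      (S.piecewise x w) (S.piecewise x' w)
    rw [hT] at h
    apply mul_left_cancel₀ hq0
    rw [Finset.mul_sum]
    simp_rw [← h]
    rw [Finset.sum_comm]
    simp_rw [sum_partialInner_piecewise hST, hκ S hS]
    simp [hR]
  have hzero : ∀ x x' : Fin n → Fin Q, ∀ i ∈ S, x i ≠ x' i → κ S x x' = 0 := by
    intro x x' i hi hne
    obtain ⟨S', T, hS', hiS', hiT, h⟩ := key i hi
    have h' := h x x'
    rw [Finset.sum_eq_zero] at h'
    · exact (mul_eq_zero.mp h').resolve_left hN0
    · intro w _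
      refine if_neg fun hall => hne ?_
      have := hall i (by simp [hiT, hiS'])
      simpa [hi] using this.symm
  have hupd : ∀ x : Fin n → Fin Q, ∀ i ∈ S, ∀ c,
      κ S (Function.update x i c) (Function.update x i c) = κ S x x := by
    intro x i hi c
    obtain ⟨S', T, hS', hiS', hiT, h⟩ := key i hi
    apply mul_left_cancel₀ hN0
    rw [h, h]
    refine Finset.sum_congr rfl fun w _ => ?_
    simp only [implies_true, if_true]
    have : ∀ j ∈ S', S.piecewise (Function.update x i c) w j = S.piecewise x w j := by
      intro j hj
      have hji : j ≠ i := fun hji => hiS' (hji ▸ hj)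
      by_cases hjS : j ∈ S <;> simp [hjS, hji]
    exact hκc S' hS' _ _ _ _ this this
  have hpw : ∀ (y x : Fin n → Fin Q) (A : Finset (Fin n)), A ⊆ S →
      κ S (A.piecewise y x) (A.piecewise y x) = κ S x x := by
    intro y x A
    induction A using Finset.induction_on with
    | empty => intro _; simp
    | insert i A hi ih =>
      intro hA
      rw [Finset.piecewise_insert, hupd _ i (hA (Finset.mem_insert_self _ _)), ih]
      exact (Finset.subset_insert _ _).trans hA
  have hconst : ∀ x y, κ S x x = κ S y y := by
    intro x y
    rw [← hpw x y S subset_rfl]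
    have : ∀ i ∈ S, x i = S.piecewise x y i := by intro i hi; simp [hi]
    exact hκc S hS _ _ _ _ this this
  have hone : ∀ x, κ S x x = 1 := by
    intro x
    have h := sum_partialInner_self S (a r0)
    rw [ha, mul_one] at h
    simp_rw [← hκe S hS, hconst _ x] at h
    rw [Finset.sum_const, Finset.card_univ, card_config, nsmul_eq_mul, Nat.cast_pow] at h
    exact mul_left_cancel₀ hN0 (h.trans (mul_one _).symm)
  split_ifs with h
  · rw [← hone x]
    exact hκc S hS _ _ _ _ (fun _ _ => rfl) (fun i hi => (h i hi).symm)
  · push Not at h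
    obtain ⟨i, hi, hne⟩ := h
    exact hzero x x' i hi hne

end Decoupling

section Distance

variable {n Q : ℕ}

theorem partialInner_eq_extendOp (S : Finset (Fin n)) (φ ψ : QuditVec n Q)
    (x x' : Fin n → Fin Q) :
    partialInner S φ ψ x x' = (Q : ℂ) ^ S.card * (star φ ⬝ᵥ
      (extendOp S (Matrix.single (fun i => x i) (fun i => x' i) 1) *ᵥ ψ)) := by
  have h1 : ∀ u, (extendOp S (Matrix.single (fun i => x i) (fun i => x' i) 1) *ᵥ ψ) u
      = if ∀ i ∈ S, u i = x i then ψ (S.piecewise x' u) else 0 := by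
    intro u
    simp only [Matrix.mulVec, dotProduct, extendOp, Matrix.of_apply, Matrix.single_apply]
    rw [Finset.sum_eq_single (S.piecewise x' u)]
    · have e1 : ∀ i, i ∉ S → u i = S.piecewise x' u i := fun i hi => by simp [hi]
      rw [if_pos e1]
      have e2 : (fun i : S => x' i) = fun i : S => S.piecewise x' u i := by
        ext i; simp
      simp only [e2, and_true]
      have e3 : ((fun i : S => x i) = fun i : S => u i) ↔ ∀ i ∈ S, u i = x i := by
        constructor
        · intro h i hi; exact (congrFun h ⟨i, hi⟩).symm
        · intro h; ext i; rw [h i i.2]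
      simp only [e3, ite_mul, one_mul, zero_mul]
    · intro v _ hv
      split_ifs with g1 g2
      · exfalso
        apply hv
        ext i
        by_cases hi : i ∈ S
        · have := congrFun g2.2 ⟨i, hi⟩
          simp [hi, ← this]
        · simp [hi, g1 i hi]
      · simp
      · simp
    · simp
  have h2 : ∀ z, star (φ (S.piecewise x z)) * ψ (S.piecewise x' z)
      = (fun u => star (φ u) * ψ (S.piecewise x' u)) (S.piecewise x z) := by
    intro z
    simp only [Finset.piecewise_idem_right]
  unfold partialInner
  rw [Finset.sum_congr rfl fun z _ => h2 z]
  refine (sum_piecewise_eq S x fun u => star (φ u) * ψ (S.piecewise x' u)).trans ?_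
  congr 1
  simp only [dotProduct, h1, Pi.star_apply, mul_ite, mul_zero]

theorem trace_extendOp_single (S : Finset (Fin n)) (x x' : Fin n → Fin Q) :
    (Q : ℂ) ^ S.card * (extendOp S (Matrix.single (fun i => x i) (fun i => x' i) 1)).trace
      = if ∀ i ∈ S, x i = x' i then (Q : ℂ) ^ n else 0 := by
  have h1 : (extendOp S (Matrix.single (fun i => x i) (fun i => x' i) 1)).trace
      = ∑ u : Fin n → Fin Q, if ∀ i ∈ S, u i = x i then
          (if ∀ i ∈ S, x i = x' i then (1 : ℂ) else 0) else 0 := by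
    simp only [Matrix.trace, Matrix.diag, extendOp, Matrix.of_apply, Matrix.single_apply,
      implies_true, if_true]
    refine Finset.sum_congr rfl fun u _ => ?_
    rw [← ite_and]
    congr 1
    simp only [funext_iff, Subtype.forall, eq_iff_iff]
    constructor
    · rintro ⟨h, h'⟩
      exact ⟨fun i hi => (h i hi).symm, fun i hi => (h i hi).trans (h' i hi).symm⟩
    · rintro ⟨h, h'⟩
      exact ⟨fun i hi => (h i hi).symm, fun i hi => (h' i hi).symm.trans (h i hi).symm⟩
  rw [h1, ← sum_piecewise_eq S x (fun _ => if ∀ i ∈ S, x i = x' i then (1 : ℂ) else 0)]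
  simp

theorem exists_orthonormal_family (C : Submodule ℂ (QuditVec n Q)) {N : ℕ}
    (hN : Module.finrank ℂ C = N) :
    ∃ a : Fin N → QuditVec n Q, (∀ r, a r ∈ C) ∧
      (∀ r r', star (a r) ⬝ᵥ a r' = if r = r' then 1 else 0) ∧
      ∀ φ ∈ C, ∃ c : Fin N → ℂ, φ = ∑ r, c r • a r := by
  set eq := (WithLp.linearEquiv 2 ℂ (QuditVec n Q)).symm with heq
  set C' := C.map (eq : QuditVec n Q →ₗ[ℂ] WithLp 2 (QuditVec n Q)) with hC'
  have hN' : Module.finrank ℂ C' = N := by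
    rw [hC', LinearEquiv.finrank_map_eq, hN]
  let b : OrthonormalBasis (Fin N) ℂ (C' : Submodule ℂ (EuclideanSpace ℂ (Fin n → Fin Q))) :=
    (stdOrthonormalBasis ℂ _).reindex (finCongr hN')
  refine ⟨fun r => (b r : EuclideanSpace ℂ (Fin n → Fin Q)).ofLp, fun r => ?_, fun r r' => ?_,
    fun φ hφ => ?_⟩
  · obtain ⟨y, hy, hyb⟩ := (b r).2
    have : (b r : EuclideanSpace ℂ (Fin n → Fin Q)).ofLp = y := congrArg WithLp.ofLp hyb.symm
    simpa only [this, SetLike.mem_coe] using hy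
  · have h := orthonormal_iff_ite.mp b.orthonormal r r'
    rw [Submodule.coe_inner, EuclideanSpace.inner_eq_star_dotProduct] at h
    rw [← h, dotProduct_comm]
  · have hmem : (eq φ) ∈ C' := ⟨φ, hφ, rfl⟩
    refine ⟨fun r => b.repr ⟨eq φ, hmem⟩ r, ?_⟩
    have h := b.sum_repr ⟨eq φ, hmem⟩
    have h2 := congrArg (fun v : C' => eq.symm (v : WithLp 2 (QuditVec n Q))) h
    simp only [LinearEquiv.symm_apply_apply] at h2
    refine h2.symm.trans ?_
    rw [Submodule.coe_sum, map_sum]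
    rfl

theorem piecewise_agree_iff {S T : Finset (Fin n)} (hST : S ⊆ T) (x x' w : Fin n → Fin Q) :
    (∀ i ∈ T, S.piecewise x w i = S.piecewise x' w i) ↔ ∀ i ∈ S, x i = x' i := by
  constructor
  · intro h i hi
    simpa [hi] using h i (hST hi)
  · intro h i _
    rw [piecewise_congr_left h]

/-- A quantum MDS code has an orthonormal basis for which the states of all small sets of
qudits are maximally mixed, jointly with the reference system for sets of size at most `t`. -/
theorem IsQMDS.exists_basis {t : ℕ} (hQ : 2 ≤ Q) (htn : t < n) (hn : n ≤ 2 * t)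
    {C : Submodule ℂ (QuditVec n Q)} (hC : IsQMDS C (2 * t - n)) :
    ∃ a : Fin (Q ^ (2 * t - n)) → QuditVec n Q, (∀ r, a r ∈ C) ∧
      (∀ r r', star (a r) ⬝ᵥ a r' = if r = r' then 1 else 0) ∧
      (∀ φ ∈ C, ∃ c : Fin (Q ^ (2 * t - n)) → ℂ, φ = ∑ r, c r • a r) ∧
      (∀ S : Finset (Fin n), S.card ≤ n - t → ∀ r r' x x',
        partialInner S (a r) (a r') x x' = if r = r' ∧ ∀ i ∈ S, x i = x' i then 1 else 0) ∧
      (∀ U : Finset (Fin n), U.card ≤ t → ∀ x x',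
        ∑ r, partialInner U (a r) (a r) x x'
          = if ∀ i ∈ U, x i = x' i then (Q : ℂ) ^ (2 * t - n) else 0) := by
  obtain ⟨hdim, D, hD, hDeq⟩ := hC
  obtain ⟨a, haC, hao, hspan⟩ := exists_orthonormal_family C hdim
  have hQ0 : 0 < Q := by omega
  have hN0 : (Q : ℂ) ^ n ≠ 0 := pow_ne_zero _ (by exact_mod_cast hQ0.ne')
  have hP1 : ∀ S : Finset (Fin n), S.card = n - t → ∀ r r' x x',
        partialInner S (a r) (a r') x x'
          = if r = r' ∧ ∀ i ∈ S, x i = x' i then 1 else 0 := by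
    intro S hS r r' x x'
    rcases Nat.eq_zero_or_pos (2 * t - n) with hk | hk
    · have hcard : Q ^ (2 * t - n) = 1 := by rw [hk, pow_zero]
      have hrr : r = r' := by
        apply Fin.ext; have := r.2; have := r'.2; omega
      subst hrr
      have h := (hD S (by omega)
        (Matrix.single (fun i => x i) (fun i => x' i) 1)).2 (by rw [hdim, hcard]) (a r) (haC r)
        (by rw [hao, if_pos rfl])
      rw [partialInner_eq_extendOp, h, mul_left_comm, trace_extendOp_single]
      simp only [true_and]
      split_ifs
      · exact inv_mul_cancel₀ hN0
      · simp
    · have hlt : 1 < Module.finrank ℂ C := by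
        rw [hdim]; exact Nat.one_lt_pow hk.ne' (by omega)
      have hκ : ∃ κ : Finset (Fin n) → (Fin n → Fin Q) → (Fin n → Fin Q) → ℂ,
          ∀ S : Finset (Fin n), S.card = n - t → ∀ r r' x x',
            partialInner S (a r) (a r') x x' = if r = r' then κ S x x' else 0 := by
        have : ∀ (S : Finset (Fin n)) (x x' : Fin n → Fin Q), ∃ c : ℂ, S.card = n - t →
            ∀ r r', partialInner S (a r) (a r') x x' = if r = r' then c else 0 := by
          intro S x x'
          by_cases hS : S.card = n - t
          · obtain ⟨c, hc⟩ := (hD S (by omega)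
              (Matrix.single (fun i => x i) (fun i => x' i) 1)).1 hlt
            refine ⟨Q ^ S.card * c, fun _ r r' => ?_⟩
            rw [partialInner_eq_extendOp, hc _ (haC r) _ (haC r'), hao]
            split_ifs <;> simp
          · exact ⟨0, fun h => absurd h hS⟩
        choose κ hκ using this
        exact ⟨κ, fun S hS r r' x x' => hκ S x x' hS r r'⟩
      obtain ⟨κ, hκ⟩ := hκ
      rw [hκ S hS]
      have htm : t - (n - t) = 2 * t - n := by omega
      rw [partialInner_eq_of_decoupled a hQ0 (n - t) t (by omega) (by omega) κ hκ
        (by rw [Fintype.card_fin, htm]) (fun r => by rw [hao, if_pos rfl]) hS, ite_and]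
  have hP1' : ∀ S : Finset (Fin n), S.card ≤ n - t → ∀ r r' x x',
        partialInner S (a r) (a r') x x'
          = if r = r' ∧ ∀ i ∈ S, x i = x' i then 1 else 0 := by
    intro S hS r r' x x'
    obtain ⟨T, hST, -, hT⟩ := Finset.exists_subsuperset_card_eq (Finset.subset_univ S)
      (n := n - t) hS (by simp)
    apply mul_left_cancel₀ hN0
    rw [← sum_partialInner_piecewise hST]
    simp_rw [hP1 T hT, piecewise_agree_iff hST]
    simp
  have hP2 : ∀ U : Finset (Fin n), U.card = t → ∀ x x',
        ∑ r, partialInner U (a r) (a r) x x'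
          = if ∀ i ∈ U, x i = x' i then (Q : ℂ) ^ (2 * t - n) else 0 := by
    intro U hU x x'
    obtain ⟨S, hSU, hS⟩ := Finset.exists_subset_card_eq (s := U) (n := n - t) (by omega)
    have htm : t - (n - t) = 2 * t - n := by omega
    rw [sum_partialInner_eq_of_decoupled a hQ0 (n - t)
      (fun S x x' => if ∀ i ∈ S, x i = x' i then 1 else 0)
      (fun S hS r r' x x' => by rw [hP1 S hS, ite_and]) hSU hS (by omega)
      (by rw [Fintype.card_fin, hU, htm]), hU, htm, ← ite_and]
    have : ((∀ i ∈ U \ S, x' i = x i) ∧ ∀ i ∈ S, x i = x' i) ↔ ∀ i ∈ U, x i = x' i := by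
      constructor
      · rintro ⟨h, h'⟩ i hi
        by_cases hiS : i ∈ S
        · exact h' i hiS
        · exact (h i (by simp [hi, hiS])).symm
      · intro h
        exact ⟨fun i hi => (h i (Finset.mem_sdiff.mp hi).1).symm, fun i hi => h i (hSU hi)⟩
    simp only [this]
    split_ifs <;> simp
  refine ⟨a, haC, hao, hspan, hP1', fun U hU x x' => ?_⟩
  obtain ⟨T, hUT, -, hT⟩ := Finset.exists_subsuperset_card_eq (Finset.subset_univ U)
      (n := t) hU (by simp; omega)
  apply mul_left_cancel₀ hN0
  rw [Finset.mul_sum]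
  simp_rw [← sum_partialInner_piecewise hUT]
  rw [Finset.sum_comm]
  simp_rw [hP2 T hT, piecewise_agree_iff hUT]
  simp

end Distance

section KernelBound

theorem mul_coeff_eq_of_orthogonal {ι κ : Type*} [Fintype ι] [DecidableEq ι] [Fintype κ]
    {M : ι → κ → ℂ} {μ : ℂ}
    (hM : ∀ i i', ∑ x, star (M i x) * M i' x = if i = i' then μ else 0) {y : ι → ℂ} {B : κ → ℂ}
    (h : ∀ x, ∑ i, y i * M i x = B x) (i : ι) : μ * y i = ∑ x, star (M i x) * B x := by
  simp_rw [← h, Finset.mul_sum]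
  rw [Finset.sum_comm]
  have : ∀ i', ∑ x, star (M i x) * (y i' * M i' x) = if i = i' then μ * y i' else 0 := by
    intro i'
    simp_rw [mul_left_comm _ (y i'), ← Finset.mul_sum, hM]
    split_ifs <;> simp [mul_comm]
  simp_rw [this]
  simp

theorem coeff_eq_zero_of_orthogonal {ι κ : Type*} [Fintype ι] [DecidableEq ι] [Fintype κ]
    {M : ι → κ → ℂ} {μ : ℂ} (hμ : μ ≠ 0)
    (hM : ∀ i i', ∑ x, star (M i x) * M i' x = if i = i' then μ else 0) {y : ι → ℂ}
    (h : ∀ x, ∑ i, y i * M i x = 0) (i : ι) : y i = 0 := by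
  have := mul_coeff_eq_of_orthogonal hM h i
  simpa [hμ] using this

/-- Fewer than `#ι` vectors of `ℂ^ι` have a common nonzero annihilator. -/
theorem exists_annihilator {ι σ : Type*} [Fintype ι] [Fintype σ]
    (hb : Fintype.card σ < Fintype.card ι) (u : σ → ι → ℂ) :
    ∃ c : ι → ℂ, c ≠ 0 ∧ ∀ s, ∑ i, c i * u s i = 0 := by
  classical
  have h := LinearMap.ker_ne_bot_of_finrank_lt (f := (Matrix.of u).mulVecLin) (by simpa using hb)
  obtain ⟨c, hc, hc0⟩ := (Submodule.ne_bot_iff _).mp h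
  refine ⟨c, hc0, fun s => ?_⟩
  have := congrFun (LinearMap.mem_ker.mp hc) s
  simp only [Matrix.mulVecLin_apply, Matrix.mulVec, dotProduct, Matrix.of_apply] at this
  simpa [mul_comm] using this

variable {R J E F G : Type*} [Fintype R] [Fintype J] [Fintype E] [Fintype F] [Fintype G]
  [DecidableEq R] [DecidableEq J] [DecidableEq E] [DecidableEq F] [DecidableEq G]

/-- An operator that maps `a r` to `a r ⊗ ε` (with the roles of the two systems `E`
exchanged) and factors over `F`, has operator Schmidt rank at least `(dim J)²` across the
cut between `J` and the rest. -/
theorem card_sq_le_of_kernel [Nonempty R] [Nonempty J] (a : R → J → E → F → G → ℂ) {l μ ν : ℂ}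
    (hμ : μ ≠ 0) (hν : ν ≠ 0)
    (H1 : ∀ α α' g g', ∑ r, ∑ β, ∑ f, star (a r α β f g) * a r α' β f g'
      = if α = α' ∧ g = g' then l else 0)
    (H2 : ∀ r r' α α' f f', ∑ β, ∑ g, star (a r α β f g) * a r' α' β f' g
      = if r = r' ∧ α = α' ∧ f = f' then μ else 0)
    (H3 : ∀ α α' β β', ∑ r, ∑ f, ∑ g, star (a r α β f g) * a r α' β' f g
      = if α = α' ∧ β = β' then ν else 0)
    {σ : Type*} [Fintype σ] (u : σ → J → J → ℂ) (v : σ → G → E → G → ℂ) (k : F → F → ℂ) (ε : E → ℂ)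
    (hε : ε ≠ 0)
    (EQ : ∀ r α' β' f' g' o, ∑ f, (∑ α, ∑ g, a r α o f g * ∑ s, u s α α' * v s g β' g') * k f f'
      = a r α' β' f' g' * ε o) :
    Fintype.card J ^ 2 ≤ Fintype.card σ := by
  by_contra! hb
  obtain ⟨c, hc0, hc⟩ := exists_annihilator (ι := J × J)
    (by rw [Fintype.card_prod]; linarith [sq (Fintype.card J)]) (fun s p => u s p.1 p.2)
  obtain ⟨o1, ho1⟩ : ∃ o, ε o ≠ 0 := by
    by_contra! h; exact hε (funext h)
  obtain ⟨⟨α1, α2⟩, hα⟩ : ∃ p, c p ≠ 0 := by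
    by_contra! h; exact hc0 (funext h)
  obtain ⟨r0⟩ := ‹Nonempty R›
  obtain ⟨j0⟩ := ‹Nonempty J›
  set K : Matrix F F ℂ := Matrix.of k with hK
  have hunit : IsUnit K := by
    rw [← Matrix.mulVec_injective_iff_isUnit, ← Matrix.coe_mulVecLin, injective_iff_map_eq_zero' K.mulVecLin]
    intro w
    refine ⟨fun hw => ?_, fun h => by simp [h]⟩
    have hw' : ∀ f, ∑ f', k f f' * w f' = 0 := fun f => congrFun hw f
    have h1 : ∀ x : E × G, ∑ f', w f' * a r0 j0 x.1 f' x.2 = 0 := by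
      rintro ⟨β', g'⟩
      have h2 : (∑ f', w f' * a r0 j0 β' f' g') * ε o1 = 0 := by
        rw [Finset.sum_mul]
        have : ∀ f', w f' * a r0 j0 β' f' g' * ε o1 = ∑ f, (∑ α, ∑ g, a r0 α o1 f g
            * ∑ s, u s α j0 * v s g β' g') * (k f f' * w f') := by
          intro f'
          rw [mul_assoc, ← EQ r0 j0 β' f' g' o1, Finset.mul_sum]
          exact Finset.sum_congr rfl fun f _ => by ring
        simp_rw [this]
        rw [Finset.sum_comm]
        simp_rw [← Finset.mul_sum, hw', mul_zero]
        simp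
      exact (mul_eq_zero.mp h2).resolve_right ho1
    funext f
    refine coeff_eq_zero_of_orthogonal hμ (M := fun f (x : E × G) => a r0 j0 x.1 f x.2) ?_ h1 f
    intro f f'
    rw [Fintype.sum_prod_type, H2]
    simp
  have hdet : IsUnit K.det := (Matrix.isUnit_iff_isUnit_det K).mp hunit
  -- undo the operation on `F`
  have EQ2 : ∀ r o α' β' g' f, ∑ α, ∑ g, a r α o f g * ∑ s, u s α α' * v s g β' g'
      = ∑ f', a r α' β' f' g' * ε o * K⁻¹ f' f := by
    intro r o α' β' g' f
    have h : Matrix.vecMul (fun f => ∑ α, ∑ g, a r α o f g * ∑ s, u s α α' * v s g β' g') K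
        = fun f' => a r α' β' f' g' * ε o := by
      funext f'
      exact EQ r α' β' f' g' o
    have h2 := congrArg (fun w => Matrix.vecMul w K⁻¹) h
    simp only [Matrix.vecMul_vecMul, Matrix.mul_nonsing_inv _ hdet, Matrix.vecMul_one] at h2
    exact congrFun h2 f
  have EQ3 : ∀ α0 g0 α' β' g', l * ∑ s, u s α0 α' * v s g0 β' g'
      = ∑ r, ∑ o, ∑ f, star (a r α0 o f g0) * ∑ f', a r α' β' f' g' * ε o * K⁻¹ f' f := by
    intro α0 g0 α' β' g'
    have h := mul_coeff_eq_of_orthogonal (ι := J × G) (κ := R × E × F) (μ := l)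
      (M := fun i x => a x.1 i.1 x.2.1 x.2.2 i.2)
      (y := fun i => ∑ s, u s i.1 α' * v s i.2 β' g')
      (B := fun x => ∑ f', a x.1 α' β' f' g' * ε x.2.1 * K⁻¹ f' x.2.2)
      (by
        rintro ⟨α, g⟩ ⟨α'', g''⟩
        simp only [Fintype.sum_prod_type, H1, Prod.mk.injEq])
      (by
        rintro ⟨r, o, f⟩
        rw [← EQ2, Fintype.sum_prod_type]
        exact Finset.sum_congr rfl fun _ _ => Finset.sum_congr rfl fun _ _ => mul_comm _ _)
      (α0, g0)
    simpa only [Fintype.sum_prod_type] using h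
  set Y : G → R → J → F → ℂ := fun g0 r α' f' =>
    ∑ α0, ∑ o, ∑ f, c (α0, α') * ε o * star (a r α0 o f g0) * K⁻¹ f' f with hY
  have hY0 : ∀ g0 r α' f', Y g0 r α' f' = 0 := by
    intro g0 r α' f'
    refine coeff_eq_zero_of_orthogonal (ι := R × J × F) (κ := E × G) hμ
      (M := fun i x => a i.1 i.2.1 x.1 i.2.2 x.2) (y := fun i => Y g0 i.1 i.2.1 i.2.2) ?_ ?_
      (r, α', f')
    · rintro ⟨r, α, f⟩ ⟨r', α', f'⟩
      simp only [Fintype.sum_prod_type, H2, Prod.mk.injEq]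
    · rintro ⟨β', g'⟩
      have h0 : ∑ α', ∑ α0, c (α0, α') * (l * ∑ s, u s α0 α' * v s g0 β' g') = 0 := by
        have e : ∀ α' α0, c (α0, α') * (l * ∑ s, u s α0 α' * v s g0 β' g')
            = ∑ s, l * v s g0 β' g' * (c (α0, α') * u s α0 α') := by
          intro α' α0
          rw [Finset.mul_sum, Finset.mul_sum]
          exact Finset.sum_congr rfl fun s _ => by ring
        simp_rw [e]
        rw [Finset.sum_comm, ← Fintype.sum_prod_type' (fun α0 α' =>
          ∑ s, l * v s g0 β' g' * (c (α0, α') * u s α0 α')), Finset.sum_comm]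
        simp_rw [← Finset.mul_sum, hc]
        simp
      rw [← h0]
      simp only [Fintype.sum_prod_type]
      rw [Finset.sum_comm]
      refine Finset.sum_congr rfl fun α' _ => ?_
      simp_rw [EQ3, hY, Finset.sum_mul, Finset.mul_sum]
      have e1 : ∀ r, ∑ f', ∑ α0, ∑ o, ∑ f, c (α0, α') * ε o * star (a r α0 o f g0) * K⁻¹ f' f
            * a r α' β' f' g'
          = ∑ α0, ∑ o, ∑ f, ∑ f', c (α0, α') * (star (a r α0 o f g0)
            * (a r α' β' f' g' * ε o * K⁻¹ f' f)) := by
        intro r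
        rw [Finset.sum_comm]
        refine Finset.sum_congr rfl fun α0 _ => ?_
        rw [Finset.sum_comm]
        refine Finset.sum_congr rfl fun o _ => ?_
        rw [Finset.sum_comm]
        exact Finset.sum_congr rfl fun f _ => Finset.sum_congr rfl fun f' _ => by ring
      simp_rw [e1]
      rw [Finset.sum_comm]
  have hY1 : ∀ g0 r α' f1, ∑ α0, ∑ o, c (α0, α') * ε o * star (a r α0 o f1 g0) = 0 := by
    intro g0 r α' f1
    have h : ∑ f', K f1 f' * Y g0 r α' f' = 0 := by simp [hY0]
    rw [← h]
    simp_rw [hY, Finset.mul_sum]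
    refine Eq.trans ?_ Finset.sum_comm
    refine Finset.sum_congr rfl fun α0 _ => ?_
    refine Eq.trans ?_ Finset.sum_comm
    refine Finset.sum_congr rfl fun o _ => ?_
    refine Eq.trans ?_ Finset.sum_comm
    have e : ∀ f, ∑ f', K f1 f' * (c (α0, α') * ε o * star (a r α0 o f g0) * K⁻¹ f' f)
        = c (α0, α') * ε o * star (a r α0 o f g0) * (if f1 = f then 1 else 0) := by
      intro f
      rw [← Matrix.one_apply, ← Matrix.mul_nonsing_inv _ hdet, Matrix.mul_apply, Finset.mul_sum]
      exact Finset.sum_congr rfl fun f' _ => by ring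
    simp_rw [e]
    simp
  have hfin := coeff_eq_zero_of_orthogonal (ι := J × E) (κ := R × F × G) hν
    (M := fun i x => a x.1 i.1 i.2 x.2.1 x.2.2) (y := fun i => star (c (i.1, α2) * ε i.2))
    (by
      rintro ⟨α, β⟩ ⟨α', β'⟩
      simp only [Fintype.sum_prod_type, H3, Prod.mk.injEq])
    (by
      rintro ⟨r, f, g⟩
      have := congrArg star (hY1 g r α2 f)
      rw [star_zero] at this
      rw [← this, Fintype.sum_prod_type, star_sum]
      refine Finset.sum_congr rfl fun _ _ => ?_
      rw [star_sum]
      exact Finset.sum_congr rfl fun _ _ => by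
        rw [star_mul _ (star _), star_star, mul_comm])
    (α1, o1)
  rw [star_eq_zero] at hfin
  exact mul_ne_zero hα ho1 hfin

end KernelBound

section Glue

variable {n Q : ℕ}

/-- Configurations of the qudits outside `T ∪ {e}`. -/
abbrev IdleConfig (Q : ℕ) (T : Finset (Fin n)) (e : Fin n) : Type :=
  {i : Fin n // i ∉ T ∧ i ≠ e} → Fin Q

/-- Configurations of the qudits in `T \ {j}`. -/
abbrev HelperConfig (Q : ℕ) (T : Finset (Fin n)) (j : Fin n) : Type :=
  {i : Fin n // i ∈ T ∧ i ≠ j} → Fin Q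

/-- The configuration with values `α` at `j`, `β` at `e`, `f` outside `T ∪ {e}`
and `g` on `T \ {j}`. -/
def glue (T : Finset (Fin n)) (e j : Fin n) (α β : Fin Q) (f : IdleConfig Q T e)
    (g : HelperConfig Q T j) : Fin n → Fin Q := fun i =>
  if he : i = e then β else if hj : i = j then α else
    if hT : i ∈ T then g ⟨i, hT, hj⟩ else f ⟨i, hT, he⟩

variable {T : Finset (Fin n)} {e j : Fin n}

theorem glue_e (α β : Fin Q) (f : IdleConfig Q T e) (g : HelperConfig Q T j) :
    glue T e j α β f g e = β := by simp [glue]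

theorem glue_j (hje : j ≠ e) (α β : Fin Q) (f : IdleConfig Q T e) (g : HelperConfig Q T j) :
    glue T e j α β f g j = α := by simp [glue, hje]

theorem glue_helper (heT : e ∉ T) (α β : Fin Q) (f : IdleConfig Q T e) (g : HelperConfig Q T j)
    (i : {i : Fin n // i ∈ T ∧ i ≠ j}) : glue T e j α β f g i = g i := by
  obtain ⟨i, hiT, hij⟩ := i
  have : i ≠ e := fun h => heT (h ▸ hiT)
  simp [glue, this, hij, hiT]

theorem glue_idle (hjT : j ∈ T) (α β : Fin Q) (f : IdleConfig Q T e) (g : HelperConfig Q T j)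
    (i : {i : Fin n // i ∉ T ∧ i ≠ e}) : glue T e j α β f g i = f i := by
  obtain ⟨i, hiT, hie⟩ := i
  have : i ≠ j := fun h => hiT (h ▸ hjT)
  simp [glue, this, hie, hiT]

/-- A configuration is determined by its four parts. -/
def glueEquiv (heT : e ∉ T) (hjT : j ∈ T) :
    (Fin Q × Fin Q × IdleConfig Q T e × HelperConfig Q T j) ≃ (Fin n → Fin Q) where
  toFun p := glue T e j p.1 p.2.1 p.2.2.1 p.2.2.2
  invFun x := (x j, x e, fun i => x i, fun i => x i)
  left_inv := by
    rintro ⟨α, β, f, g⟩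
    have hje : j ≠ e := fun h => heT (h ▸ hjT)
    simp only [glue_e, glue_j hje, glue_helper heT, glue_idle hjT]
  right_inv x := by
    ext i
    simp only [glue]
    split_ifs with h1 h2
    · rw [h1]
    · rw [h2]
    · rfl
    · rfl

theorem sum_glue {M : Type*} [AddCommMonoid M] (heT : e ∉ T) (hjT : j ∈ T)
    (F : (Fin n → Fin Q) → M) :
    ∑ x, F x = ∑ α, ∑ β, ∑ f, ∑ g, F (glue T e j α β f g) := by
  rw [← Equiv.sum_comp (glueEquiv heT hjT) F]
  simp only [Fintype.sum_prod_type]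
  rfl

theorem card_helperConfig (hjT : j ∈ T) :
    Fintype.card (HelperConfig Q T j) = Q ^ (T.card - 1) := by
  rw [Fintype.card_fun, Fintype.card_fin]
  congr 1
  rw [Fintype.card_subtype, ← Finset.card_erase_of_mem hjT]
  congr 1
  ext i
  simp [and_comm]

theorem card_idleConfig (heT : e ∉ T) :
    Fintype.card (IdleConfig Q T e) = Q ^ (n - T.card - 1) := by
  rw [Fintype.card_fun, Fintype.card_fin]
  congr 1
  have : n - T.card = (Tᶜ).card := by rw [Finset.card_compl, Fintype.card_fin]
  rw [Fintype.card_subtype, this, ← Finset.card_erase_of_mem (Finset.mem_compl.mpr heT)]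
  congr 1
  ext i
  simp [and_comm]

/-- The amplitudes of an orthonormal basis of a quantum MDS code, arranged as a tensor with
one leg for qudit `j`, one for `e`, one for the idle qudits and one for the other helpers. -/
theorem IsQMDS.exists_tensor {t : ℕ} (hQ : 2 ≤ Q) (ht : 1 < t) (htn : t < n) (hn : n ≤ 2 * t)
    {C : Submodule ℂ (QuditVec n Q)} (hC : IsQMDS C (2 * t - n)) (heT : e ∉ T)
    (hT : T.card = t) :
    ∃ a : Fin (Q ^ (2 * t - n)) → QuditVec n Q, (∀ r, a r ∈ C) ∧
      (∀ φ ∈ C, ∃ c : Fin (Q ^ (2 * t - n)) → ℂ, φ = ∑ r, c r • a r) ∧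
      (∀ r r', star (a r) ⬝ᵥ a r' = if r = r' then 1 else 0) ∧ ∀ j (_ : j ∈ T), ∃ l μ ν : ℝ, 0 < l ∧ 0 < μ ∧ 0 < ν ∧
      (∀ α α' g g', ∑ r, ∑ β, ∑ f, star (a r (glue T e j α β f g)) * a r (glue T e j α' β f g')
        = if α = α' ∧ g = g' then (l : ℂ) else 0) ∧
      (∀ r r' α α' f f', ∑ β, ∑ g,
        star (a r (glue T e j α β f g)) * a r' (glue T e j α' β f' g)
        = if r = r' ∧ α = α' ∧ f = f' then (μ : ℂ) else 0) ∧
      (∀ α α' β β', ∑ r, ∑ f, ∑ g,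
        star (a r (glue T e j α β f g)) * a r (glue T e j α' β' f g)
        = if α = α' ∧ β = β' then (ν : ℂ) else 0) ∧
      (∀ r r' β β' f f', ∑ α, ∑ g,
        star (a r (glue T e j α β f g)) * a r' (glue T e j α β' f' g)
        = if r = r' ∧ β = β' ∧ f = f' then (l : ℂ) else 0) := by
  obtain ⟨a, haC, hao, hspan, hP1, hP2⟩ := hC.exists_basis hQ htn hn
  have hQ0 : 0 < Q := by omega
  have hQC : (Q : ℂ) ≠ 0 := by exact_mod_cast hQ0.ne'
  have hQR : (0 : ℝ) < Q := by exact_mod_cast hQ0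
  refine ⟨a, haC, hspan, hao, fun j hjT => ?_⟩
  have hje : j ≠ e := fun h => heT (h ▸ hjT)
  have hcF := card_idleConfig (Q := Q) heT
  have hcG := card_helperConfig (Q := Q) hjT
  rw [hT] at hcF hcG
  have pw : ∀ (S : Finset (Fin n)) (α β f g α' β' f' g'),
      S.piecewise (glue T e j α β f g) (glue T e j α' β' f' g' : Fin n → Fin Q)
      = glue T e j (if j ∈ S then α else α') (if e ∈ S then β else β')
        (fun i => if (i : Fin n) ∈ S then f i else f' i)
        (fun i => if (i : Fin n) ∈ S then g i else g' i) := by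
    intro S α β f g α' β' f' g'
    ext i
    by_cases hi : i ∈ S
    · rw [Finset.piecewise_eq_of_mem _ _ _ hi]
      simp only [glue]
      split_ifs with h1 h2 h3 h4 <;> simp_all
    · rw [Finset.piecewise_eq_of_notMem _ _ _ hi]
      simp only [glue]
      split_ifs with h1 h2 h3 h4 <;> simp_all
  have ag : ∀ (S : Finset (Fin n)) (α β f g α' β' f' g'),
      (∀ i ∈ S, (glue T e j α β f g : Fin n → Fin Q) i = glue T e j α' β' f' g' i) ↔
      ((j ∈ S → α = α') ∧ (e ∈ S → β = β') ∧
        (∀ i : {i : Fin n // i ∉ T ∧ i ≠ e}, (i : Fin n) ∈ S → f i = f' i) ∧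
        (∀ i : {i : Fin n // i ∈ T ∧ i ≠ j}, (i : Fin n) ∈ S → g i = g' i)) := by
    intro S α β f g α' β' f' g'
    constructor
    · intro h
      refine ⟨fun hj => ?_, fun he => ?_, fun i hi => ?_, fun i hi => ?_⟩
      · simpa only [glue_j hje] using h j hj
      · simpa only [glue_e] using h e he
      · simpa only [glue_idle hjT] using h i hi
      · simpa only [glue_helper heT] using h i hi
    · rintro ⟨h1, h2, h3, h4⟩ i hi
      simp only [glue]
      split_ifs with g1 g2 g3
      · exact h2 (g1 ▸ hi)
      · exact h1 (g2 ▸ hi)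
      · exact h4 ⟨i, g3, g2⟩ hi
      · exact h3 ⟨i, g3, g1⟩ hi
  have k1 : (Q : ℂ) ^ t = Q * Q ^ (t - 1) := by
    rw [← pow_succ', Nat.sub_add_cancel (by omega)]
  have k2 : (Q : ℂ) ^ (n - t) = Q * Q ^ (n - t - 1) := by
    rw [← pow_succ', Nat.sub_add_cancel (by omega)]
  have k3 : (Q : ℂ) ^ t = Q ^ (n - t) * Q ^ (2 * t - n) := by
    rw [← pow_add]; congr 1; omega
  refine ⟨1 / Q ^ (n - t), 1 / Q ^ (n - t), Q ^ (2 * t - n) / Q ^ 2, by positivity,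
    by positivity, by positivity, ?_, ?_, ?_, ?_⟩
  · intro α α' g g'
    have h := hP2 T hT.le (glue T e j α α (fun _ => α) g) (glue T e j α' α (fun _ => α) g')
    have hF : ∀ i : {i : Fin n // i ∉ T ∧ i ≠ e}, (i : Fin n) ∉ T := fun i => i.2.1
    have hG : ∀ i : {i : Fin n // i ∈ T ∧ i ≠ j}, (i : Fin n) ∈ T := fun i => i.2.1
    have hag : (∀ i ∈ T, glue T e j α α (fun _ => α) g i
        = glue T e j α' α (fun _ => α) g' i)
        ↔ α = α' ∧ g = g' := by
      rw [ag]
      simp only [hjT, hG, funext_iff, forall_true_left, implies_true, true_and]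
    unfold partialInner at h
    simp only [sum_glue heT hjT, pw, hag] at h
    simp only [hjT, heT, hF, hG, if_true, if_false, Finset.sum_const, Finset.card_univ, hcG,
      Fintype.card_fin, nsmul_eq_mul, ← Finset.mul_sum, Nat.cast_pow] at h
    push_cast
    have hne : (Q : ℂ) * Q ^ (t - 1) ≠ 0 := by rw [← k1]; exact pow_ne_zero _ hQC
    apply mul_left_cancel₀ hne
    rw [mul_assoc, h, ← k1, k3]
    split_ifs
    · field_simp
    · simp
  · intro r r' α α' f f'
    set S := insert j (Tᶜ.erase e) with hSdef
    have hS : S.card = n - t := by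
      rw [Finset.card_insert_of_notMem (by simp [hjT]),
        Finset.card_erase_of_mem (Finset.mem_compl.mpr heT), Finset.card_compl,
        Fintype.card_fin, hT]
      omega
    have h := hP1 S hS.le r r' (glue T e j α α f (fun _ => α)) (glue T e j α' α f' (fun _ => α))
    have hF : ∀ i : {i : Fin n // i ∉ T ∧ i ≠ e}, (i : Fin n) ∈ S :=
      fun i => by simp [hSdef, i.2]
    have hG : ∀ i : {i : Fin n // i ∈ T ∧ i ≠ j}, (i : Fin n) ∉ S :=
      fun i => by simp [hSdef, i.2]
    have hj : j ∈ S := by simp [hSdef]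
    have he : e ∉ S := by simp [hSdef, hje.symm]
    have hag : (∀ i ∈ S, glue T e j α α f (fun _ => α) i
        = glue T e j α' α f' (fun _ => α) i)
        ↔ α = α' ∧ f = f' := by
      rw [ag]
      simp only [hj, hF, funext_iff, forall_true_left, implies_true, true_and, and_true]
    unfold partialInner at h
    simp only [sum_glue heT hjT, pw, hag] at h
    simp only [hj, he, hF, hG, if_true, if_false, Finset.sum_const, Finset.card_univ, hcF,
      Fintype.card_fin, nsmul_eq_mul, ← Finset.mul_sum, Nat.cast_pow] at h
    push_cast
    have hne : (Q : ℂ) * Q ^ (n - t - 1) ≠ 0 := by rw [← k2]; exact pow_ne_zero _ hQC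
    apply mul_left_cancel₀ hne
    rw [mul_assoc, h, ← k2]
    split_ifs
    · field_simp
    · simp
  · intro α α' β β'
    set S : Finset (Fin n) := {j, e} with hSdef
    have hS : S.card ≤ t := (Finset.card_le_two).trans ht
    have h := hP2 S hS (glue T e j α β (fun _ => α) (fun _ => α))
      (glue T e j α' β' (fun _ => α) (fun _ => α))
    have hF : ∀ i : {i : Fin n // i ∉ T ∧ i ≠ e}, (i : Fin n) ∉ S := fun i => by
      simp only [hSdef, Finset.mem_insert, Finset.mem_singleton, not_or]
      exact ⟨fun h => i.2.1 (h ▸ hjT), i.2.2⟩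
    have hG : ∀ i : {i : Fin n // i ∈ T ∧ i ≠ j}, (i : Fin n) ∉ S := fun i => by
      simp only [hSdef, Finset.mem_insert, Finset.mem_singleton, not_or]
      exact ⟨i.2.2, fun h => heT (h ▸ i.2.1)⟩
    have hj : j ∈ S := by simp [hSdef]
    have he : e ∈ S := by simp [hSdef]
    have hag : (∀ i ∈ S, glue T e j α β (fun _ => α) (fun _ => α) i
        = glue T e j α' β' (fun _ => α) (fun _ => α) i)
        ↔ α = α' ∧ β = β' := by
      rw [ag]
      simp only [hj, he, forall_true_left, implies_true, and_true]
    unfold partialInner at h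
    simp only [sum_glue heT hjT, pw, hag] at h
    simp only [hj, he, hF, hG, if_true, if_false, Finset.sum_const, Finset.card_univ,
      Fintype.card_fin, nsmul_eq_mul, ← Finset.mul_sum] at h
    push_cast
    have hne : (Q : ℂ) * Q ≠ 0 := mul_ne_zero hQC hQC
    apply mul_left_cancel₀ hne
    rw [mul_assoc, h]
    split_ifs
    · field_simp
    · simp
  · intro r r' β β' f f'
    have hS : Tᶜ.card = n - t := by rw [Finset.card_compl, Fintype.card_fin, hT]
    have h := hP1 Tᶜ hS.le r r' (glue T e j β β f (fun _ => β)) (glue T e j β β' f' (fun _ => β))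
    have hF : ∀ i : {i : Fin n // i ∉ T ∧ i ≠ e}, (i : Fin n) ∈ Tᶜ :=
      fun i => by simp [i.2]
    have hG : ∀ i : {i : Fin n // i ∈ T ∧ i ≠ j}, (i : Fin n) ∉ Tᶜ :=
      fun i => by simp [i.2]
    have hj : j ∉ Tᶜ := by simp [hjT]
    have he : e ∈ Tᶜ := by simp [heT]
    have hag : (∀ i ∈ Tᶜ, glue T e j β β f (fun _ => β) i
        = glue T e j β β' f' (fun _ => β) i)
        ↔ β = β' ∧ f = f' := by
      rw [ag]
      simp only [he, hF, funext_iff, forall_true_left, implies_true, true_and, and_true]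
    unfold partialInner at h
    simp only [sum_glue heT hjT, pw, hag] at h
    simp only [hj, he, hF, hG, if_true, if_false, Finset.sum_const, Finset.card_univ, hcF,
      Fintype.card_fin, nsmul_eq_mul, ← Finset.mul_sum, Nat.cast_pow] at h
    push_cast
    have hne : (Q : ℂ) * Q ^ (n - t - 1) ≠ 0 := by rw [← k2]; exact pow_ne_zero _ hQC
    apply mul_left_cancel₀ hne
    rw [mul_assoc, h, ← k2]
    split_ifs
    · field_simp
    · simp

end Glue

section Branch

variable {n : ℕ}

/-- `ψ` is a state of systems of dimensions `d`. -/
def SupportedIn (d : Node n → ℕ) (ψ : NetState n) : Prop :=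
  ∀ x, (∃ p, d p ≤ x p) → ψ x = 0

theorem SupportedIn.applyLocal {d : Node n → ℕ} {ψ : NetState n} (hψ : SupportedIn d ψ)
    (p : Node n) {a b : ℕ} (K : Matrix (Fin b) (Fin a) ℂ) :
    SupportedIn (Function.update d p b) (applyLocal p K ψ) := by
  rintro x ⟨q, hq⟩
  unfold _root_.applyLocal
  split_ifs with h
  · have hqp : q ≠ p := by
      rintro rfl
      rw [Function.update_self] at hq
      omega
    rw [Function.update_of_ne hqp] at hq
    refine Finset.sum_eq_zero fun i _ => ?_
    rw [hψ _ ⟨q, by rwa [Function.update_of_ne hqp]⟩, mul_zero]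
  · rfl

/-- The action on basis labels that defines `applySend`. -/
def sendMap (A B : Node n) (η : ℕ) (x : Node n → ℕ) : Node n → ℕ :=
  Function.update (Function.update x A (x A * η + x B % η)) B (x B / η)

theorem sendMap_fst {A B : Node n} (hAB : A ≠ B) (η : ℕ) (x : Node n → ℕ) :
    sendMap A B η x A = x A * η + x B % η := by
  simp [sendMap, hAB]

theorem sendMap_snd (A B : Node n) (η : ℕ) (x : Node n → ℕ) :
    sendMap A B η x B = x B / η := by
  simp [sendMap]

theorem sendMap_of_ne {A B p : Node n} (hA : p ≠ A) (hB : p ≠ B) (η : ℕ) (x : Node n → ℕ) :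
    sendMap A B η x p = x p := by
  simp [sendMap, hA, hB]

theorem sendMap_sendMap {A B : Node n} (hAB : A ≠ B) {η : ℕ} (hη : 0 < η) (x : Node n → ℕ) :
    sendMap A B η (sendMap B A η x) = x := by
  ext p
  by_cases hA : p = A
  · subst hA
    rw [sendMap_fst hAB, sendMap_snd, sendMap_fst hAB.symm, Nat.mul_add_mod_of_lt
      (Nat.mod_lt _ hη)]
    exact Nat.div_add_mod' _ _
  by_cases hB : p = B
  · subst hB
    rw [sendMap_snd, sendMap_fst hAB.symm, mul_comm, Nat.mul_add_div hη,
      Nat.div_eq_of_lt (Nat.mod_lt _ hη), add_zero]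
  rw [sendMap_of_ne hA hB, sendMap_of_ne hB hA]

theorem applySend_apply (A B : Node n) (η : ℕ) (ψ : NetState n) (x : Node n → ℕ) :
    applySend A B η ψ x = ψ (sendMap A B η x) := rfl

theorem SupportedIn.applySend {d : Node n → ℕ} {ψ : NetState n} (hψ : SupportedIn d ψ)
    {A B : Node n} (hAB : A ≠ B) {r η : ℕ} (hη : 0 < η) (hd : d A = r * η) :
    SupportedIn (Function.update (Function.update d A r) B (d B * η)) (applySend A B η ψ) := by
  rintro x ⟨q, hq⟩
  rw [applySend_apply]
  by_cases hB : q = B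
  · subst hB
    rw [Function.update_self] at hq
    refine hψ _ ⟨q, ?_⟩
    rw [sendMap_snd]
    exact (Nat.le_div_iff_mul_le hη).mpr hq
  rw [Function.update_of_ne hB] at hq
  by_cases hA : q = A
  · subst hA
    rw [Function.update_self] at hq
    refine hψ _ ⟨q, ?_⟩
    rw [sendMap_fst hAB, hd]
    exact le_add_right (Nat.mul_le_mul_right _ hq)
  · rw [Function.update_of_ne hA] at hq
    exact hψ _ ⟨q, by rwa [sendMap_of_ne hA hB]⟩

theorem exists_applyLocal_ne_zero {d : Node n → ℕ} {ψ : NetState n} (hψ : SupportedIn d ψ)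
    (h0 : ψ ≠ 0) (p : Node n) {m : ℕ} {k : Fin m → ℕ}
    (K : (o : Fin m) → Matrix (Fin (k o)) (Fin (d p)) ℂ) (hK : ∑ o, (K o)ᴴ * K o = 1) :
    ∃ o, applyLocal p (K o) ψ ≠ 0 := by
  by_contra! h
  apply h0
  funext x
  by_cases hx : x p < d p
  · have h1 : ∀ o, ∀ b : Fin (k o), ∑ i, K o b i * ψ (Function.update x p (i : ℕ)) = 0 := by
      intro o b
      have := congrFun (h o) (Function.update x p (b : ℕ))
      simpa [applyLocal, b.2] using this
    have h2 : ((∑ o, (K o)ᴴ * K o) *ᵥ fun i => ψ (Function.update x p (i : ℕ))) = 0 := by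
      rw [Matrix.sum_mulVec]
      refine Finset.sum_eq_zero fun o _ => ?_
      rw [← Matrix.mulVec_mulVec]
      have : (K o *ᵥ fun i => ψ (Function.update x p (i : ℕ))) = 0 := funext (h1 o)
      rw [this, Matrix.mulVec_zero]
    rw [hK, Matrix.one_mulVec] at h2
    simpa using congrFun h2 ⟨x p, hx⟩
  · exact hψ x ⟨p, not_lt.mp hx⟩

theorem applySend_ne_zero {d : Node n → ℕ} {ψ : NetState n} (hψ : SupportedIn d ψ)
    (h0 : ψ ≠ 0) {A B : Node n} (hAB : A ≠ B) {r η : ℕ} (hd : d A = r * η) :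
    0 < η ∧ applySend A B η ψ ≠ 0 := by
  obtain ⟨x, hx⟩ := Function.ne_iff.mp h0
  have hη : 0 < η := by
    rcases Nat.eq_zero_or_pos η with rfl | h
    · exact absurd (hψ x ⟨A, by simp [hd]⟩) hx
    · exact h
  refine ⟨hη, fun h => hx ?_⟩
  have := congrFun h (sendMap B A η x)
  rwa [applySend_apply, sendMap_sendMap hAB hη] at this

/-- `applyLocal` as a linear map. -/
def applyLocalLin {a b : ℕ} (p : Node n) (K : Matrix (Fin b) (Fin a) ℂ) :
    NetState n →ₗ[ℂ] NetState n where
  toFun := applyLocal p K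
  map_add' φ ψ := by
    funext x
    simp only [applyLocal, Pi.add_apply]
    split_ifs
    · rw [← Finset.sum_add_distrib]
      exact Finset.sum_congr rfl fun _ _ => by ring
    · simp
  map_smul' c ψ := by
    funext x
    simp only [applyLocal, Pi.smul_apply, smul_eq_mul, RingHom.id_apply]
    split_ifs
    · rw [Finset.mul_sum]
      exact Finset.sum_congr rfl fun _ _ => by ring
    · simp

/-- `applySend` as a linear map. -/
def applySendLin (A B : Node n) (η : ℕ) : NetState n →ₗ[ℂ] NetState n where
  toFun := applySend A B η
  map_add' _ _ := rfl
  map_smul' _ _ := rfl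

theorem applyLocal_mul {a b : ℕ} {q : Node n} {s : Set (Node n)} (hq : q ∉ s)
    (K : Matrix (Fin b) (Fin a) ℂ) (u : NetState n) {v : NetState n} (hv : DependsOn v s) :
    applyLocal q K (u * v) = applyLocal q K u * v := by
  funext x
  have : ∀ i, v (Function.update x q i) = v x := by
    intro i
    refine hv fun p hp => Function.update_of_ne ?_ _ _
    rintro rfl
    exact hq hp
  simp only [applyLocal, Pi.mul_apply, this]
  split_ifs
  · rw [Finset.sum_mul]
    exact Finset.sum_congr rfl fun _ _ => by ring
  · simp

theorem DependsOn.applyLocal {a b : ℕ} {q : Node n} {s : Set (Node n)} (hq : q ∈ s)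
    (K : Matrix (Fin b) (Fin a) ℂ) {u : NetState n} (hu : DependsOn u s) :
    DependsOn (applyLocal q K u) s := by
  intro x y hxy
  simp only [_root_.applyLocal, hxy q hq]
  have : ∀ i, u (Function.update x q i) = u (Function.update y q i) := by
    intro i
    refine hu fun p hp => ?_
    by_cases h : p = q
    · subst h; simp
    · simp [h, hxy p hp]
  simp only [this]

theorem DependsOn.applySend {A B : Node n} {s : Set (Node n)} (hA : A ∈ s) (hB : B ∈ s) (η : ℕ)
    {u : NetState n} (hu : DependsOn u s) : DependsOn (applySend A B η u) s := by
  intro x y hxy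
  rw [applySend_apply, applySend_apply]
  refine hu fun p hp => ?_
  unfold sendMap
  rw [hxy A hA, hxy B hB]
  by_cases h : p = B
  · subst h; simp
  · by_cases h' : p = A
    · subst h'; simp [h]
    · simp [h, h', hxy p hp]

theorem applySend_mul {A B : Node n} {s : Set (Node n)} (hA : A ∉ s) (hB : B ∉ s) (η : ℕ)
    (u : NetState n) {v : NetState n} (hv : DependsOn v s) :
    applySend A B η (u * v) = applySend A B η u * v := by
  funext x
  simp only [applySend_apply, Pi.mul_apply]
  congr 1
  refine hv fun p hp => sendMap_of_ne ?_ ?_ _ _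
  · rintro rfl; exact hA hp
  · rintro rfl; exact hB hp

/-- The linear map `L` acts by a sum of at most `b` product operators across the cut between
node `p` and the nodes in `U`, by a product operator on the nodes in `F`, and trivially on the
nodes in `E`. -/
def FactorsAcross (p : Node n) (U F E : Set (Node n)) (b : ℕ)
    (L : NetState n →ₗ[ℂ] NetState n) : Prop :=
  ∃ (σ : Type) (_ : Fintype σ) (A B : σ → NetState n → NetState n) (K : NetState n → NetState n),
    Fintype.card σ ≤ b ∧
    (∀ s f, DependsOn f {p} → DependsOn (A s f) {p}) ∧
    (∀ s h, DependsOn h U → DependsOn (B s h) U) ∧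
    (∀ g, DependsOn g F → DependsOn (K g) F) ∧
    ∀ f h g w, DependsOn f {p} → DependsOn h U → DependsOn g F → DependsOn w E →
      L (f * h * g * w) = (∑ s, A s f * B s h) * K g * w

theorem FactorsAcross.mono {p : Node n} {U F E : Set (Node n)} {b b' : ℕ}
    {L : NetState n →ₗ[ℂ] NetState n} (h : FactorsAcross p U F E b L) (hb : b ≤ b') :
    FactorsAcross p U F E b' L := by
  obtain ⟨σ, hσ, A, B, K, hc, h'⟩ := h
  exact ⟨σ, hσ, A, B, K, hc.trans hb, h'⟩

/-- Precomposition with a sum of `η` product operators across the cut. -/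
theorem FactorsAcross.comp_sum {p : Node n} {U F E : Set (Node n)} {b : ℕ}
    {L : NetState n →ₗ[ℂ] NetState n} (hL : FactorsAcross p U F E b L)
    {M : NetState n →ₗ[ℂ] NetState n} {η : ℕ} (a c : Fin η → NetState n → NetState n)
    (ha : ∀ s f, DependsOn f {p} → DependsOn (a s f) {p})
    (hc : ∀ s h, DependsOn h U → DependsOn (c s h) U)
    (hM : ∀ f h g w, DependsOn f {p} → DependsOn h U → DependsOn g F → DependsOn w E →
      M (f * h * g * w) = (∑ s, a s f * c s h) * g * w) :
    FactorsAcross p U F E (η * b) (L ∘ₗ M) := by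
  obtain ⟨σ, _, A, B, K, hcard, hA, hB, hK, hL⟩ := hL
  refine ⟨Fin η × σ, inferInstance, fun s f => A s.2 (a s.1 f), fun s h => B s.2 (c s.1 h), K,
    ?_, fun s f hf => hA _ _ (ha _ _ hf), fun s h hh => hB _ _ (hc _ _ hh), hK, ?_⟩
  · rw [Fintype.card_prod, Fintype.card_fin]
    exact Nat.mul_le_mul_left _ hcard
  · intro f h g w hf hh hg hw
    rw [LinearMap.comp_apply, hM f h g w hf hh hg hw, Finset.sum_mul, Finset.sum_mul, map_sum,
      Fintype.sum_prod_type, Finset.sum_mul, Finset.sum_mul]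
    refine Finset.sum_congr rfl fun s _ => ?_
    exact hL _ _ _ _ (ha _ _ hf) (hc _ _ hh) hg hw

/-- Sending a system of dimension `η` from `p` to `q` acts by `η` product operators. -/
theorem applySend_mul_eq_sum {p q : Node n} (hpq : p ≠ q) {η : ℕ} (hη : 0 < η)
    {U : Set (Node n)} (hpU : p ∉ U) {f h : NetState n} (hf : DependsOn f {p})
    (hh : DependsOn h U) :
    applySend p q η (f * h) = ∑ s : Fin η,
      (fun x => f (Function.update x p (x p * η + s))) *
      (fun x => if x q % η = s then h (Function.update x q (x q / η)) else 0) := by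
  funext x
  rw [applySend_apply, Pi.mul_apply, Finset.sum_apply, Finset.sum_eq_single ⟨_, Nat.mod_lt (x q) hη⟩]
  · simp only [Pi.mul_apply, if_true]
    congr 1
    · refine hf fun i hi => ?_
      obtain rfl : i = p := hi
      rw [sendMap_fst hpq, Function.update_self]
    · refine hh fun i hi => ?_
      have hip : i ≠ p := by rintro rfl; exact hpU hi
      by_cases hiq : i = q
      · subst hiq; rw [sendMap_snd, Function.update_self]
      · rw [sendMap_of_ne hip hiq, Function.update_of_ne hiq]
  · intro s _ hs
    have : x q % η ≠ s := fun h => hs (Fin.ext h.symm)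
    simp [this]
  · simp

/-- Sending a system of dimension `η` from `q` to `p` acts by `η` product operators. -/
theorem applySend_mul_eq_sum' {p q : Node n} (hpq : p ≠ q) {η : ℕ} (hη : 0 < η)
    {U : Set (Node n)} (hpU : p ∉ U) {f h : NetState n} (hf : DependsOn f {p})
    (hh : DependsOn h U) :
    applySend q p η (f * h) = ∑ s : Fin η,
      (fun x => if x p % η = s then f (Function.update x p (x p / η)) else 0) *
      (fun x => h (Function.update x q (x q * η + s))) := by
  funext x
  rw [applySend_apply, Pi.mul_apply, Finset.sum_apply, Finset.sum_eq_single ⟨_, Nat.mod_lt (x p) hη⟩]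
  · simp only [Pi.mul_apply, if_true]
    congr 1
    · refine hf fun i hi => ?_
      obtain rfl : i = p := hi
      rw [sendMap_snd, Function.update_self]
    · refine hh fun i hi => ?_
      have hip : i ≠ p := by rintro rfl; exact hpU hi
      by_cases hiq : i = q
      · subst hiq; rw [sendMap_fst hpq.symm, Function.update_self]
      · rw [sendMap_of_ne hiq hip, Function.update_of_ne hiq]
  · intro s _ hs
    have : x p % η ≠ s := fun h => hs (Fin.ext h.symm)
    simp [this]
  · simp

theorem DependsOn.update_fst {s : Set (Node n)} {q : Node n} (hq : q ∈ s) {u : NetState n}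
    (hu : DependsOn u s) (c : ℕ → ℕ) (P : ℕ → Prop) [DecidablePred P] :
    DependsOn (fun x => if P (x q) then u (Function.update x q (c (x q))) else 0) s := by
  intro x y hxy
  have : u (Function.update x q (c (x q))) = u (Function.update y q (c (y q))) := by
    refine hu fun p hp => ?_
    by_cases h : p = q
    · subst h; simp [hxy p hp]
    · simp [h, hxy p hp]
  simp only [this]
  rw [hxy q hq]

/-- Every protocol has a branch with nonzero outcome on a given nonzero input, and that branch
factors across the cut between a leaf `p` and the other nodes of the network. -/
theorem Protocol.exists_branch {e : Fin n} {H : Finset (Sym2 (Node n))} {p hub : Node n}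
    {U F : Set (Node n)} (hpU : p ∉ U) (hpF : p ∉ F) (hUF : Disjoint U F) (hhub : hub ∈ U)
    (hcover : ∀ q, q ≠ some e → q = p ∨ q ∈ U ∨ q ∈ F)
    (hH : ∀ A B, s(A, B) ∈ H → (A ∈ U ∧ B ∈ U) ∨ (A = p ∧ B = hub) ∨ (A = hub ∧ B = p))
    {d : Node n → ℕ} (P : Protocol e H d) {ψ : NetState n} (hψ : SupportedIn d ψ) (h0 : ψ ≠ 0) :
    ∃ L : NetState n →ₗ[ℂ] NetState n, L ψ ≠ 0 ∧
      (∀ R φ, P.AlwaysEnds R φ → ∃ d', R d' (L φ)) ∧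
      FactorsAcross p U F {some e} (P.beta s(hub, p)) L := by
  induction P generalizing ψ with
  | halt d =>
    refine ⟨LinearMap.id, h0, fun R φ h => ⟨d, h⟩, Unit, inferInstance, fun _ f => f, fun _ f => f,
      fun f => f, by simp [Protocol.beta], by simp, by simp, by simp, ?_⟩
    intro f h g w _ _ _ _
    simp
  | localOp d q hq m k hk K hK next ih =>
    obtain ⟨o, ho⟩ := exists_applyLocal_ne_zero hψ h0 q K hK
    obtain ⟨L, hL0, hLR, hLF⟩ := ih o (hψ.applyLocal q (K o)) ho
    refine ⟨L ∘ₗ applyLocalLin q (K o), hL0, fun R φ h => hLR R _ (h o), ?_⟩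
    have hLF' := hLF.mono (b' := (Protocol.localOp d q hq m k hk K hK next).beta s(hub, p))
      (Finset.le_sup (f := fun o => (next o).beta s(hub, p)) (Finset.mem_univ o))
    obtain ⟨σ, hσ, A, B, N, hcard, hA, hB, hN, hL⟩ := hLF'
    have hqe : q ∉ ({some e} : Set (Node n)) := hq
    rcases hcover q hq with rfl | hqU | hqF
    · refine ⟨σ, hσ, fun s f => A s (applyLocal q (K o) f), B, N, hcard,
        fun s f hf => hA _ _ (hf.applyLocal (Set.mem_singleton _) _), hB, hN, ?_⟩
      intro f h g w hf hh hg hw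
      change L (applyLocal q (K o) (f * h * g * w)) = _
      rw [applyLocal_mul hqe _ _ hw, applyLocal_mul hpF _ _ hg, applyLocal_mul hpU _ _ hh]
      exact hL _ _ _ _ (hf.applyLocal (Set.mem_singleton _) _) hh hg hw
    · have hqp : q ∉ ({p} : Set (Node n)) := by
        rintro rfl; exact hpU hqU
      have hqF : q ∉ F := Set.disjoint_left.mp hUF hqU
      refine ⟨σ, hσ, A, fun s h => B s (applyLocal q (K o) h), N, hcard, hA,
        fun s f hf => hB _ _ (hf.applyLocal hqU _), hN, ?_⟩
      intro f h g w hf hh hg hw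
      change L (applyLocal q (K o) (f * h * g * w)) = _
      rw [applyLocal_mul hqe _ _ hw, applyLocal_mul hqF _ _ hg, mul_comm f,
        applyLocal_mul hqp _ _ hf, mul_comm _ f]
      exact hL _ _ _ _ hf (hh.applyLocal hqU _) hg hw
    · have hqp : q ∉ ({p} : Set (Node n)) := by
        rintro rfl; exact hpF hqF
      have hqU : q ∉ U := Set.disjoint_right.mp hUF hqF
      refine ⟨σ, hσ, A, B, fun g => N (applyLocal q (K o) g), hcard, hA, hB,
        fun g hg => hN _ (hg.applyLocal hqF _), ?_⟩
      intro f h g w hf hh hg hw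
      change L (applyLocal q (K o) (f * h * g * w)) = _
      rw [applyLocal_mul hqe _ _ hw, mul_comm (f * h), ← mul_assoc, applyLocal_mul hqU _ _ hh,
        applyLocal_mul hqp _ _ hf, mul_assoc (applyLocal q (K o) g), mul_comm _ (f * h)]
      exact hL _ _ _ _ hf hh (hg.applyLocal hqF _) hw
  | send d A B hA hB hAB hABH r η hd next ih =>
    obtain ⟨hη, hne⟩ := applySend_ne_zero hψ h0 hAB hd
    obtain ⟨L, hL0, hLR, hLF⟩ := ih (hψ.applySend hAB hη hd) hne
    refine ⟨L ∘ₗ applySendLin A B η, hL0, fun R φ h => hLR R _ h, ?_⟩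
    have hAe : A ∉ ({some e} : Set (Node n)) := hA
    have hBe : B ∉ ({some e} : Set (Node n)) := hB
    rcases hH A B hABH with ⟨hAU, hBU⟩ | ⟨rfl, rfl⟩ | ⟨rfl, rfl⟩
    · have hAp : A ∉ ({p} : Set (Node n)) := by rintro rfl; exact hpU hAU
      have hBp : B ∉ ({p} : Set (Node n)) := by rintro rfl; exact hpU hBU
      have hbeta : (Protocol.send d A B hA hB hAB hABH r η hd next).beta s(hub, p)
          = next.beta s(hub, p) := by
        have : s(hub, p) ≠ s(A, B) := by
          intro h
          rcases Sym2.mem_iff.mp (h ▸ Sym2.mem_mk_right hub p) with h' | h'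
          · exact hAp h'.symm
          · exact hBp h'.symm
        simp [Protocol.beta, this]
      rw [hbeta]
      obtain ⟨σ, hσ, A', B', N, hcard, hA', hB', hN, hL⟩ := hLF
      refine ⟨σ, hσ, A', fun s h => B' s (applySend A B η h), N, hcard, hA',
        fun s f hf => hB' _ _ (hf.applySend hAU hBU _), hN, ?_⟩
      intro f h g w hf hh hg hw
      change L (applySend A B η (f * h * g * w)) = _
      rw [applySend_mul hAe hBe _ _ hw,
        applySend_mul (Set.disjoint_left.mp hUF hAU) (Set.disjoint_left.mp hUF hBU) _ _ hg,
        mul_comm f, applySend_mul hAp hBp _ _ hf, mul_comm _ f]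
      exact hL _ _ _ _ hf (hh.applySend hAU hBU _) hg hw
    · have hbeta : (Protocol.send d A B hA hB hAB hABH r η hd next).beta s(B, A)
          = η * next.beta s(B, A) := by
        simp [Protocol.beta, Sym2.eq_swap]
      rw [hbeta]
      refine hLF.comp_sum (fun s f x => f (Function.update x A (x A * η + s)))
        (fun s h x => if x B % η = s then h (Function.update x B (x B / η)) else 0)
        (fun s f hf => ?_) (fun s h hh => ?_) fun f h g w hf hh hg hw => ?_
      · simpa using hf.update_fst (q := A) (Set.mem_singleton _) (fun i => i * η + s) (fun _ => True)
      · exact hh.update_fst (q := B) hhub (fun i => i / η) (fun i => i % η = s)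
      · change applySend A B η (f * h * g * w) = _
        rw [applySend_mul hAe hBe _ _ hw,
          applySend_mul hpF (Set.disjoint_left.mp hUF hhub) _ _ hg,
          applySend_mul_eq_sum hAB hη hpU hf hh]
    · have hbeta : (Protocol.send d A B hA hB hAB hABH r η hd next).beta s(A, B)
          = η * next.beta s(A, B) := by
        simp [Protocol.beta]
      rw [hbeta]
      refine hLF.comp_sum
        (fun s f x => if x B % η = s then f (Function.update x B (x B / η)) else 0)
        (fun s h x => h (Function.update x A (x A * η + s)))
        (fun s f hf => ?_) (fun s h hh => ?_) fun f h g w hf hh hg hw => ?_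
      · exact hf.update_fst (q := B) (Set.mem_singleton _) (fun i => i / η) (fun i => i % η = s)
      · simpa using hh.update_fst (q := A) hhub (fun i => i * η + s) (fun _ => True)
      · change applySend A B η (f * h * g * w) = _
        rw [applySend_mul hAe hBe _ _ hw,
          applySend_mul (Set.disjoint_left.mp hUF hhub) hpF _ _ hg,
          applySend_mul_eq_sum' hAB.symm hη hpU hf hh]

end Branch

section LowerBound

variable {n Q : ℕ}

open Classical in
/-- The indicator function of the configurations that agree with `y` on `s`. -/
noncomputable def agreeOn (s : Set (Node n)) (y : Node n → ℕ) : NetState n :=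
  fun x => if ∀ q ∈ s, x q = y q then 1 else 0

theorem dependsOn_agreeOn (s : Set (Node n)) (y : Node n → ℕ) : DependsOn (agreeOn s y) s := by
  intro x x' h
  have : (∀ q ∈ s, x q = y q) ↔ ∀ q ∈ s, x' q = y q :=
    forall₂_congr fun q hq => by rw [h q hq]
  simp only [agreeOn]
  classical exact if_congr this rfl rfl

theorem agreeOn_union (s s' : Set (Node n)) (y : Node n → ℕ) :
    agreeOn (s ∪ s') y = agreeOn s y * agreeOn s' y := by
  classical
  funext x
  simp only [agreeOn, Pi.mul_apply, Set.mem_union, or_imp, forall_and, ite_and]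
  split_ifs <;> simp

theorem agreeOn_congr {s : Set (Node n)} {y y' : Node n → ℕ} (h : ∀ q ∈ s, y q = y' q) :
    agreeOn s y = agreeOn s y' := by
  funext x
  have : (∀ q ∈ s, x q = y q) ↔ ∀ q ∈ s, x q = y' q :=
    forall₂_congr fun q hq => by rw [h q hq]
  simp only [agreeOn]
  classical exact if_congr this rfl rfl

/-- The labels of the nodes in the initial state, for the configuration `y` of the qudits. -/
def initialLabels (y : Fin n → Fin Q) : Node n → ℕ := fun q => q.elim 0 fun i => y i

/-- The labels of the nodes in the final state, for the configuration `y` of the qudits and the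
label `o` of the erased node. -/
def finalLabels (e : Fin n) (y : Fin n → Fin Q) (o : Fin Q) : Node n → ℕ :=
  fun q => q.elim (y e) fun i => if i = e then o else y i

theorem toAmp_val (φ : QuditVec n Q) (y : Fin n → Fin Q) : toAmp φ (fun i => (y i : ℕ)) = φ y := by
  simp [toAmp]

theorem initialState_initialLabels (φ : QuditVec n Q) (y : Fin n → Fin Q) :
    initialState φ (initialLabels y) = φ y := by
  simp [initialState, initialLabels, toAmp]

theorem correctedState_finalLabels (e : Fin n) (φ : QuditVec n Q) (ε : Fin Q → ℂ)
    (y : Fin n → Fin Q) (o : Fin Q) : correctedState e φ ε (finalLabels e y o) = φ y * ε o := by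
  have h1 : (fun i => finalLabels e y o (some i)) = Function.update (fun i => (y i : ℕ)) e o := by
    funext i
    by_cases hi : i = e
    · subst hi; simp [finalLabels]
    · simp [finalLabels, hi]
  have h2 : Function.update (Function.update (fun i => (y i : ℕ)) e (o : ℕ)) e
      (finalLabels e y o none) = fun i => (y i : ℕ) := by
    rw [Function.update_idem]
    exact Function.update_eq_self _ _
  simp only [correctedState, h1, h2, toAmp_val]
  simp [finalLabels]

theorem initialState_single (y : Fin n → Fin Q) :
    initialState (Pi.single y 1) = agreeOn Set.univ (initialLabels y) := by
  classical
  funext x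
  simp only [initialState, agreeOn, toAmp, Set.mem_univ, true_imp_iff, Pi.single_apply]
  by_cases h : ∀ q, x q = initialLabels y q
  · have h0 : x none = 0 := h none
    have hs : ∀ i, x (some i) = y i := fun i => h (some i)
    simp only [h0, hs, if_pos, h, implies_true]
    simp
  · rw [if_neg h]
    split_ifs with h0 h1 h2
    · exfalso
      apply h
      intro q
      cases q with
      | none => exact h0
      | some i => exact congrArg (fun z : Fin n → Fin Q => ((z i : Fin Q) : ℕ)) h2
    · rfl
    · rfl
    · rfl

theorem initialState_eq_sum (φ : QuditVec n Q) :
    initialState φ = ∑ y, φ y • initialState (Pi.single y 1) := by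
  funext x
  rw [Finset.sum_apply]
  simp only [Pi.smul_apply, smul_eq_mul, initialState, toAmp]
  split_ifs with h0 h1
  · simp [Pi.single_apply]
  · simp
  · simp

theorem supportedIn_initialState (hQ : 0 < Q) (φ : QuditVec n Q) :
    SupportedIn (fun _ => Q) (initialState φ) := by
  rintro x ⟨q, hq⟩
  unfold initialState toAmp
  cases q with
  | none =>
    have : Q ≤ x none := hq
    rw [if_neg (by omega)]
  | some i =>
    split_ifs with h0 h1
    · exact absurd (h1 i) (not_lt.mpr hq)
    · rfl
    · rfl

theorem eq_of_correctedState_add {e : Fin n} {φ ψ : QuditVec n Q} (hφ : star φ ⬝ᵥ φ = 1)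
    (hψ : star ψ ⬝ᵥ ψ = 1) (hφψ : star φ ⬝ᵥ ψ = 0) (hψφ : star ψ ⬝ᵥ φ = 0)
    {ε ε' ε'' : Fin Q → ℂ}
    (h : correctedState e φ ε + correctedState e ψ ε' = correctedState e (φ + ψ) ε'') :
    ε = ε' := by
  have h1 : ∀ o, ε o • φ + ε' o • ψ = ε'' o • (φ + ψ) := by
    intro o
    funext y
    have := congrFun h (finalLabels e y o)
    simp only [Pi.add_apply, correctedState_finalLabels] at this
    simp only [Pi.add_apply, Pi.smul_apply, smul_eq_mul]
    rw [mul_comm (ε o), mul_comm (ε' o), this, mul_comm]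
  funext o
  have h2 := congrArg (fun v => star φ ⬝ᵥ v) (h1 o)
  have h3 := congrArg (fun v => star ψ ⬝ᵥ v) (h1 o)
  simp only [dotProduct_add, dotProduct_smul, hφ, hψ, hφψ, hψφ, smul_eq_mul] at h2 h3
  simp only [mul_one, mul_zero, add_zero, zero_add] at h2 h3
  rw [h2, h3]

variable {T : Finset (Fin n)} {e j₁ : Fin n}

/-- The nodes that are connected by the network: those storing the qudits in `T` and the
replacement node. -/
def activeNodes (T : Finset (Fin n)) : Set (Node n) := {q | ∀ i, q = some i → i ∈ T}

/-- The nodes outside the network, except for the erased one. -/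
def idleNodes (T : Finset (Fin n)) (e : Fin n) : Set (Node n) := {q | ∃ i, q = some i ∧ i ∉ T ∧ i ≠ e}

theorem mem_starAtHelper {A B : Node n} (h : s(A, B) ∈ starAtHelper T j₁) :
    (A = some j₁ ∧ B ∈ activeNodes T ∧ B ≠ some j₁) ∨
      (B = some j₁ ∧ A ∈ activeNodes T ∧ A ≠ some j₁) := by
  simp only [starAtHelper, Finset.mem_insert, Finset.mem_image, Finset.mem_erase] at h
  rcases h with h | ⟨j, ⟨hj, hjT⟩, h⟩
  · rcases Sym2.eq_iff.mp h with ⟨rfl, rfl⟩ | ⟨rfl, rfl⟩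
    · left; simp [activeNodes]
    · right; simp [activeNodes]
  · rcases Sym2.eq_iff.mp h with ⟨rfl, rfl⟩ | ⟨rfl, rfl⟩
    · left; simp [activeNodes, hj, hjT]
    · right; simp [activeNodes, hj, hjT]

theorem exists_branch_starAtHelper {C : Submodule ℂ (QuditVec n Q)} {R : Type*}
    [DecidableEq R] [Nonempty R] (hQ : 0 < Q) (a : R → QuditVec n Q) (haC : ∀ r, a r ∈ C)
    (hao : ∀ r r', star (a r) ⬝ᵥ a r' = if r = r' then 1 else 0) (hj₁ : j₁ ∈ T)
    {P : Protocol e (starAtHelper T j₁) (fun _ => Q)} (hP : CorrectsErasure C e P)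
    {p : Node n} (hp : p ∈ activeNodes T) (hpj : p ≠ some j₁) :
    ∃ (ε : Fin Q → ℂ) (L : NetState n →ₗ[ℂ] NetState n), ε ≠ 0 ∧
      (∀ r, L (initialState (a r)) = correctedState e (a r) ε) ∧
      FactorsAcross p (activeNodes T \ {p}) (idleNodes T e) {some e}
        (P.beta s(some j₁, p)) L := by
  obtain ⟨r0⟩ := ‹Nonempty R›
  have h0 : initialState (a r0) ≠ 0 := by
    intro h
    have : a r0 = 0 := by
      funext y
      rw [← initialState_initialLabels (a r0), h]; rfl
    have h1 := hao r0 r0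
    rw [this] at h1
    simp at h1
  have hact : ∀ {q}, q ∈ activeNodes T → q ∉ idleNodes T e := by
    rintro _ hq ⟨i, rfl, hiT, -⟩
    exact hiT (hq i rfl)
  obtain ⟨L, hL0, hLR, hLF⟩ := P.exists_branch (p := p) (hub := some j₁)
    (U := activeNodes T \ {p}) (F := idleNodes T e) (by simp) (hact hp)
    (Set.disjoint_left.mpr fun q hq => hact hq.1)
    ⟨fun i hi => by obtain rfl := Option.some_injective _ hi; exact hj₁, fun h => hpj h.symm⟩
    (by
      intro q hq
      by_cases hqp : q = p
      · exact Or.inl hqp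
      · right
        by_cases hqA : q ∈ activeNodes T
        · exact Or.inl ⟨hqA, hqp⟩
        · right
          simp only [activeNodes, Set.mem_ofPred_eq, not_forall] at hqA
          obtain ⟨i, hi, hiT⟩ := hqA
          exact ⟨i, hi, hiT, fun h => hq (h ▸ hi)⟩)
    (by
      have hub : some j₁ ∈ activeNodes T \ {p} :=
        ⟨fun i hi => by obtain rfl := Option.some_injective _ hi; exact hj₁, fun h => hpj h.symm⟩
      intro A B hAB
      rcases mem_starAtHelper hAB with ⟨rfl, hB, -⟩ | ⟨rfl, hA, -⟩
      · by_cases hBp : B = p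
        · exact Or.inr (Or.inr ⟨rfl, hBp⟩)
        · exact Or.inl ⟨hub, hB, hBp⟩
      · by_cases hAp : A = p
        · exact Or.inr (Or.inl ⟨hAp, rfl⟩)
        · exact Or.inl ⟨⟨hA, hAp⟩, hub⟩)
    (supportedIn_initialState hQ (a r0)) h0
  have hcor : ∀ φ ∈ C, ∃ ε, L (initialState φ) = correctedState e φ ε := by
    intro φ hφ
    obtain ⟨d', -, ε, hε⟩ := hLR _ _ (hP φ hφ)
    exact ⟨ε, hε⟩
  obtain ⟨ε, hε⟩ := hcor _ (haC r0)
  refine ⟨ε, L, ?_, fun r => ?_, hLF⟩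
  · rintro rfl
    apply hL0
    rw [hε]
    funext x
    simp [correctedState]
  · by_cases hr : r = r0
    · rw [hr, hε]
    · obtain ⟨ε', hε'⟩ := hcor _ (haC r)
      obtain ⟨ε'', hε''⟩ := hcor _ (C.add_mem (haC r) (haC r0))
      have hadd : initialState (a r + a r0) = initialState (a r) + initialState (a r0) := by
        funext x
        simp only [initialState, toAmp, Pi.add_apply]
        split_ifs <;> simp
      rw [hadd, map_add, hε, hε'] at hε''
      rw [hε', eq_of_correctedState_add (by rw [hao, if_pos rfl]) (by rw [hao, if_pos rfl])
        (by rw [hao, if_neg hr]) (by rw [hao, if_neg (Ne.symm hr)]) hε'']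

theorem agreeOn_univ_eq_mul (p : Node n) (y : Node n → ℕ) :
    agreeOn Set.univ y = agreeOn {p} y * agreeOn (activeNodes T \ {p}) y
      * agreeOn (idleNodes T e) y * agreeOn {some e} y := by
  rw [← agreeOn_union, ← agreeOn_union, ← agreeOn_union]
  congr 1
  refine (Set.eq_univ_of_forall fun q => ?_).symm
  by_cases hqp : q = p
  · simp [hqp]
  by_cases hqe : q = some e
  · simp [hqe]
  by_cases hqA : q ∈ activeNodes T
  · simp [hqA, hqp]
  · have : q ∈ idleNodes T e := by
      simp only [activeNodes, Set.mem_ofPred_eq, not_forall] at hqA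
      obtain ⟨i, hi, hiT⟩ := hqA
      exact ⟨i, hi, hiT, fun h => hqe (h ▸ hi)⟩
    simp [this]

theorem sq_le_beta_helper {t : ℕ} (hQ : 2 ≤ Q) (ht : 1 < t) (htn : t < n) (hn : n ≤ 2 * t)
    {C : Submodule ℂ (QuditVec n Q)} (hC : IsQMDS C (2 * t - n)) (heT : e ∉ T)
    (hT : T.card = t) (hj₁ : j₁ ∈ T) {P : Protocol e (starAtHelper T j₁) (fun _ => Q)}
    (hP : CorrectsErasure C e P) {j : Fin n} (hj : j ∈ T) (hjj : j ≠ j₁) :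
    Q ^ 2 ≤ P.beta s(some j₁, some j) := by
  obtain ⟨a, haC, -, hao, htens⟩ := hC.exists_tensor hQ ht htn hn heT hT
  obtain ⟨l, μ, ν, hl, hμ, hν, H1, H2, H3, -⟩ := htens j hj
  have : Nonempty (Fin (Q ^ (2 * t - n))) := ⟨⟨0, by positivity⟩⟩
  let z : Fin Q := ⟨0, by omega⟩
  have : Nonempty (Fin Q) := ⟨z⟩
  have hjA : some j ∈ activeNodes T := fun i hi => by
    obtain rfl := Option.some_injective _ hi; exact hj
  have hje : j ≠ e := fun h => heT (h ▸ hj)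
  obtain ⟨ε, L, hε, hL, σ, _, A, B, K, hcard, hA, hB, hK, hLF⟩ :=
    exists_branch_starAtHelper (by omega) a haC hao hj₁ hP hjA (by simpa using hjj)
  refine le_trans ?_ hcard
  have key := card_sq_le_of_kernel (fun r α β f g => a r (glue T e j α β f g)) (μ := μ) (ν := ν)
    (by exact_mod_cast hμ.ne') (by exact_mod_cast hν.ne') H1 H2 H3
    (fun s α α' => A s (agreeOn {some j} (fun _ => α)) (fun _ => α'))
    (fun s g β' g' => B s (agreeOn (activeNodes T \ {some j})
      (initialLabels (glue T e j z z (fun _ => z) g)))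
      (finalLabels e (glue T e j z β' (fun _ => z) g') z))
    (fun f f' => K (agreeOn (idleNodes T e) (initialLabels (glue T e j z z f (fun _ => z))))
      (finalLabels e (glue T e j z z f' (fun _ => z)) z)) ε hε ?_
  · simpa using key
  intro r α' β' f' g' o
  have h := congrFun (hL r) (finalLabels e (glue T e j α' β' f' g') o)
  rw [correctedState_finalLabels] at h
  rw [← h, initialState_eq_sum, map_sum, Finset.sum_apply, sum_glue heT hj]
  have hglueU : ∀ (α β f g) (α₁ β₁ f₁), ∀ q ∈ activeNodes T \ {some j},
      initialLabels (glue T e j α β f g : Fin n → Fin Q) q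
        = initialLabels (glue T e j α₁ β₁ f₁ g) q := by
    rintro α β f g α₁ β₁ f₁ (_ | i) ⟨hqA, hqj⟩
    · rfl
    · have hiT := hqA i rfl
      have hij : i ≠ j := fun h => hqj (h ▸ rfl)
      exact congrArg Fin.val ((glue_helper heT α β f g ⟨i, hiT, hij⟩).trans
        (glue_helper heT α₁ β₁ f₁ g ⟨i, hiT, hij⟩).symm)
  have hglueU' : ∀ (α β f g o) (α₁ f₁ o₁), ∀ q ∈ activeNodes T \ {some j},
      finalLabels e (glue T e j α β f g : Fin n → Fin Q) o q
        = finalLabels e (glue T e j α₁ β f₁ g) o₁ q := by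
    rintro α β f g o α₁ f₁ o₁ (_ | i) ⟨hqA, hqj⟩
    · simp [finalLabels, glue_e]
    · have hiT := hqA i rfl
      have hij : i ≠ j := fun h => hqj (h ▸ rfl)
      have hie : i ≠ e := fun h => heT (h ▸ hiT)
      simp only [finalLabels, Option.elim_some, if_neg hie]
      exact congrArg Fin.val ((glue_helper heT α β f g ⟨i, hiT, hij⟩).trans
        (glue_helper heT α₁ β f₁ g ⟨i, hiT, hij⟩).symm)
  have hglueF : ∀ (α β f g) (α₁ β₁ g₁), ∀ q ∈ idleNodes T e,
      initialLabels (glue T e j α β f g : Fin n → Fin Q) q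
        = initialLabels (glue T e j α₁ β₁ f g₁) q := by
    rintro α β f g α₁ β₁ g₁ _ ⟨i, rfl, hiT, hie⟩
    exact congrArg Fin.val ((glue_idle hj α β f g ⟨i, hiT, hie⟩).trans
        (glue_idle hj α₁ β₁ f g₁ ⟨i, hiT, hie⟩).symm)
  have hglueF' : ∀ (α β f g o) (α₁ β₁ g₁ o₁), ∀ q ∈ idleNodes T e,
      finalLabels e (glue T e j α β f g : Fin n → Fin Q) o q
        = finalLabels e (glue T e j α₁ β₁ f g₁) o₁ q := by
    rintro α β f g o α₁ β₁ g₁ o₁ _ ⟨i, rfl, hiT, hie⟩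
    simp only [finalLabels, Option.elim_some, if_neg hie]
    exact congrArg Fin.val ((glue_idle hj α β f g ⟨i, hiT, hie⟩).trans
        (glue_idle hj α₁ β₁ f g₁ ⟨i, hiT, hie⟩).symm)
  have hterm : ∀ α β f g,
      L (a r (glue T e j α β f g) • initialState (Pi.single (glue T e j α β f g) 1))
        (finalLabels e (glue T e j α' β' f' g') o)
      = a r (glue T e j α β f g) * ((∑ s, A s (agreeOn {some j} (fun _ => α)) (fun _ => α')
        * B s (agreeOn (activeNodes T \ {some j})
            (initialLabels (glue T e j z z (fun _ => z) g)))
            (finalLabels e (glue T e j z β' (fun _ => z) g') z))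
        * K (agreeOn (idleNodes T e) (initialLabels (glue T e j z z f (fun _ => z))))
            (finalLabels e (glue T e j z z f' (fun _ => z)) z)
        * if o = β then 1 else 0) := by
    intro α β f g
    rw [map_smul, initialState_single, agreeOn_univ_eq_mul (T := T) (e := e) (some j),
      hLF _ _ _ _ (dependsOn_agreeOn _ _) (dependsOn_agreeOn _ _) (dependsOn_agreeOn _ _)
        (dependsOn_agreeOn _ _)]
    simp only [Pi.smul_apply, Pi.mul_apply, Finset.sum_apply, smul_eq_mul]
    congr 3
    · refine Finset.sum_congr rfl fun s _ => ?_
      congr 1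
      · rw [agreeOn_congr (s := {some j}) (y' := fun _ => (α : ℕ))]
        · refine hA s _ (dependsOn_agreeOn _ _) ?_
          rintro q hq
          obtain rfl : q = some j := hq
          simp [finalLabels, hje, glue_j hje]
        · rintro q hq
          obtain rfl : q = some j := hq
          simp [initialLabels, glue_j hje]
      · rw [agreeOn_congr (hglueU α β f g z z (fun _ => z))]
        exact hB s _ (dependsOn_agreeOn _ _) (hglueU' _ _ _ _ _ _ _ _)
    · rw [agreeOn_congr (hglueF α β f g z z (fun _ => z))]
      exact hK _ (dependsOn_agreeOn _ _) (hglueF' _ _ _ _ _ _ _ _ _)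
    · simp [agreeOn, finalLabels, initialLabels, glue_e, Fin.ext_iff]
  simp_rw [hterm]
  refine Eq.trans ?_ Finset.sum_comm
  refine Eq.trans ?_ (Finset.sum_eq_single o (fun β _ hβ => by simp [Ne.symm hβ])
    (by simp)).symm
  simp only [if_true, mul_one]
  refine Eq.trans ?_ Finset.sum_comm
  refine Finset.sum_congr rfl fun f _ => ?_
  rw [Finset.sum_mul]
  refine Finset.sum_congr rfl fun α _ => ?_
  rw [Finset.sum_mul]
  exact Finset.sum_congr rfl fun g _ => by ring

theorem le_beta_replacement {t : ℕ} (hQ : 2 ≤ Q) (ht : 1 < t) (htn : t < n) (hn : n ≤ 2 * t)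
    {C : Submodule ℂ (QuditVec n Q)} (hC : IsQMDS C (2 * t - n)) (heT : e ∉ T)
    (hT : T.card = t) (hj₁ : j₁ ∈ T) {P : Protocol e (starAtHelper T j₁) (fun _ => Q)}
    (hP : CorrectsErasure C e P) : Q ≤ P.beta s(some j₁, none) := by
  obtain ⟨a, haC, -, hao, htens⟩ := hC.exists_tensor hQ ht htn hn heT hT
  obtain ⟨l, μ, ν, hl, hμ, hν, H1, H2, H3, -⟩ := htens j₁ hj₁
  have : Nonempty (Fin (Q ^ (2 * t - n))) := ⟨⟨0, by positivity⟩⟩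
  let z : Fin Q := ⟨0, by omega⟩
  have hnA : none ∈ activeNodes T := fun i hi => by simp at hi
  obtain ⟨ε, L, hε, hL, σ, _, A, B, K, hcard, hA, hB, hK, hLF⟩ :=
    exists_branch_starAtHelper (by omega) a haC hao hj₁ hP hnA (by simp)
  refine le_trans ?_ hcard
  by_contra! hlt
  obtain ⟨c, hc0, hc⟩ := exists_annihilator (ι := Fin Q) (by simpa using hlt)
    (fun s β => A s (agreeOn {none} (fun _ => 0)) (fun _ => (β : ℕ)))
  obtain ⟨o, ho⟩ : ∃ o, ε o ≠ 0 := by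
    by_contra! h; exact hε (funext h)
  apply hc0
  funext β
  refine coeff_eq_zero_of_orthogonal (κ := Fin (Q ^ (2 * t - n)) × IdleConfig Q T e ×
    HelperConfig Q T j₁) (μ := ν) (by exact_mod_cast hν.ne')
    (M := fun β x => a x.1 (glue T e j₁ z β x.2.1 x.2.2)) ?_ ?_ β
  · intro β β'
    simp only [Fintype.sum_prod_type, H3, true_and]
  rintro ⟨r, f, g⟩
  have hfin : ∀ β, ∀ q, q ≠ none → finalLabels e (glue T e j₁ z β f g) o q
      = finalLabels e (glue T e j₁ z z f g) o q := by
    rintro β (_ | i) hq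
    · exact absurd rfl hq
    · simp only [finalLabels, Option.elim_some]
      split_ifs with h
      · rfl
      · simp [glue, h]
  have hne : ∀ {q}, q ∈ activeNodes T \ {none} → q ≠ none := fun hq h => hq.2 h
  have hneF : ∀ {q}, q ∈ idleNodes T e → q ≠ none := by
    rintro _ ⟨i, rfl, -⟩; simp
  have h : ∀ β, a r (glue T e j₁ z β f g) * ε o = ∑ s,
      A s (agreeOn {none} (fun _ => 0)) (fun _ => (β : ℕ)) * ∑ y, a r y *
        (B s (agreeOn (activeNodes T \ {none}) (initialLabels y))
          (finalLabels e (glue T e j₁ z z f g) o)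
        * K (agreeOn (idleNodes T e) (initialLabels y)) (finalLabels e (glue T e j₁ z z f g) o)
        * agreeOn {some e} (initialLabels y) (finalLabels e (glue T e j₁ z z f g) o)) := by
    intro β
    rw [← correctedState_finalLabels, ← hL r, initialState_eq_sum, map_sum, Finset.sum_apply]
    simp_rw [Finset.mul_sum]
    rw [Finset.sum_comm]
    refine Finset.sum_congr rfl fun y _ => ?_
    rw [map_smul, initialState_single, agreeOn_univ_eq_mul (T := T) (e := e) none,
      hLF _ _ _ _ (dependsOn_agreeOn _ _) (dependsOn_agreeOn _ _) (dependsOn_agreeOn _ _)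
        (dependsOn_agreeOn _ _)]
    simp only [Pi.smul_apply, Pi.mul_apply, Finset.sum_apply, smul_eq_mul]
    rw [hK _ (dependsOn_agreeOn _ _) (fun q hq => hfin β q (hneF hq)),
      dependsOn_agreeOn {some e} (initialLabels y) (fun q hq => hfin β q (by
        obtain rfl : q = some e := hq
        simp)), Finset.sum_mul, Finset.sum_mul, Finset.mul_sum]
    refine Finset.sum_congr rfl fun s _ => ?_
    rw [hB s _ (dependsOn_agreeOn _ _) (fun q hq => hfin β q (hne hq)),
      agreeOn_congr (s := {none}) (y' := fun _ => 0),
      hA s _ (dependsOn_agreeOn _ _) (y := fun _ => (β : ℕ))]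
    · ring
    · rintro q hq
      obtain rfl : q = none := hq
      simp [finalLabels, glue_e]
    · rintro q hq
      obtain rfl : q = none := hq
      simp [initialLabels]
  have h2 : (∑ β, c β * a r (glue T e j₁ z β f g)) * ε o = 0 := by
    rw [Finset.sum_mul]
    simp_rw [mul_assoc, h, Finset.mul_sum]
    rw [Finset.sum_comm]
    refine Finset.sum_eq_zero fun s _ => ?_
    simp_rw [← Finset.mul_sum, ← mul_assoc, ← Finset.sum_mul, hc, zero_mul]
  exact (mul_eq_zero.mp h2).resolve_right ho

end LowerBound

section Realizable

variable {n : ℕ}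

theorem Protocol.alwaysEnds_supportedIn {e : Fin n} {H : Finset (Sym2 (Node n))}
    {d : Node n → ℕ} (P : Protocol e H d) {ψ : NetState n} (hψ : SupportedIn d ψ) :
    P.AlwaysEnds SupportedIn ψ := by
  induction P generalizing ψ with
  | halt d => exact hψ
  | localOp d q hq m k hk K hK next ih => exact fun o => ih o (hψ.applyLocal q (K o))
  | send d A B hA hB hAB hABH r η hd next ih =>
    refine ih ?_
    by_cases h0 : ψ = 0
    · subst h0
      exact fun _ _ => rfl
    · exact hψ.applySend hAB (applySend_ne_zero hψ h0 hAB hd).1 hd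

/-- There is a protocol with costs `b` whose guarantees are described by `S`. -/
def Realizable (e : Fin n) (H : Finset (Sym2 (Node n))) (d : Node n → ℕ)
    (S : ((Node n → ℕ) → NetState n → Prop) → NetState n → Prop)
    (b : Sym2 (Node n) → ℕ) : Prop :=
  ∃ P : Protocol e H d, (∀ R ψ, P.AlwaysEnds R ψ ↔ S R ψ) ∧ ∀ h, P.beta h = b h

variable {e : Fin n} {H : Finset (Sym2 (Node n))}

theorem Realizable.congr {d : Node n → ℕ} {S S'} {b b' : Sym2 (Node n) → ℕ}
    (h : Realizable e H d S b) (hS : S' = S) (hb : ∀ h, b' h = b h) :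
    Realizable e H d S' b' := by
  rw [hS, funext hb]
  exact h

theorem Realizable.halt (d : Node n → ℕ) :
    Realizable e H d (fun R ψ => R d ψ) (fun _ => 1) :=
  ⟨.halt d, fun _ _ => Iff.rfl, fun _ => rfl⟩

theorem Realizable.send {d d' : Node n → ℕ} {S} {b : Sym2 (Node n) → ℕ}
    (h : Realizable e H d' S b) {A B : Node n} (hA : A ≠ some e) (hB : B ≠ some e)
    (hAB : A ≠ B) (hH : s(A, B) ∈ H) (r η : ℕ) (hd : d A = r * η)
    (hd' : d' = Function.update (Function.update d A r) B (d B * η)) :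
    Realizable e H d (fun R ψ => S R (applySend A B η ψ))
      (fun h => (if h = s(A, B) then η else 1) * b h) := by
  subst hd'
  obtain ⟨P, hP, hb⟩ := h
  exact ⟨.send d A B hA hB hAB hH r η hd P, fun R ψ => hP R _, fun h => by
    rw [Protocol.beta, hb]⟩

theorem Realizable.localOp {d : Node n → ℕ} {p : Node n} (hp : p ≠ some e) {m D k : ℕ}
    (hm : 0 < m) (hk : 0 < k) (hD : d p = D) (K : Fin m → Matrix (Fin k) (Fin D) ℂ)
    (hK : ∑ o, (K o)ᴴ * K o = 1) {S} {b : Sym2 (Node n) → ℕ}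
    (h : Realizable e H (Function.update d p k) S b) :
    Realizable e H d (fun R ψ => ∀ o, S R (applyLocal p (K o) ψ)) b := by
  subst hD
  obtain ⟨P, hP, hb⟩ := h
  refine ⟨.localOp d p hp m (fun _ => k) (fun _ => hk) K hK (fun _ => P),
    fun R ψ => forall_congr' fun o => hP R _, fun h => ?_⟩
  rw [Protocol.beta, hb]
  have : (Finset.univ : Finset (Fin m)).Nonempty := ⟨⟨0, hm⟩, Finset.mem_univ _⟩
  exact Finset.sup_const this _

/-- The action on basis labels of sending the systems of the nodes in a list to the hub. -/
def gatherMap (hub : Node n) (Q : ℕ) : List (Node n) → (Node n → ℕ) → Node n → ℕ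
  | [], x => x
  | j :: l, x => sendMap j hub Q (gatherMap hub Q l x)

/-- The action on basis labels of sending systems from the hub to the nodes in a list. -/
def spreadMap (hub : Node n) (Q : ℕ) : List (Node n) → (Node n → ℕ) → Node n → ℕ
  | [], x => x
  | j :: l, x => spreadMap hub Q l (sendMap hub j Q x)

variable {hub : Node n} {Q : ℕ}

theorem gatherMap_spreadMap (hQ : 0 < Q) {l : List (Node n)} (hl : hub ∉ l)
    (x : Node n → ℕ) : gatherMap hub Q l (spreadMap hub Q l x) = x := by
  induction l generalizing x with
  | nil => rfl
  | cons j l ih =>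
    rw [List.mem_cons, not_or] at hl
    rw [gatherMap, spreadMap, ih hl.2, sendMap_sendMap (Ne.symm hl.1) hQ]

theorem spreadMap_gatherMap (hQ : 0 < Q) {l : List (Node n)} (hl : hub ∉ l)
    (x : Node n → ℕ) : spreadMap hub Q l (gatherMap hub Q l x) = x := by
  induction l generalizing x with
  | nil => rfl
  | cons j l ih =>
    rw [List.mem_cons, not_or] at hl
    rw [gatherMap, spreadMap, sendMap_sendMap hl.1 hQ, ih hl.2]

theorem gatherMap_of_notMem {l : List (Node n)} {q : Node n} (hq : q ∉ l) (hqh : q ≠ hub)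
    (x : Node n → ℕ) : gatherMap hub Q l x q = x q := by
  induction l with
  | nil => rfl
  | cons j l ih =>
    rw [List.mem_cons, not_or] at hq
    rw [gatherMap, sendMap_of_ne hq.1 hqh, ih hq.2]

theorem spreadMap_of_notMem {l : List (Node n)} {q : Node n} (hq : q ∉ l) (hqh : q ≠ hub)
    (x : Node n → ℕ) : spreadMap hub Q l x q = x q := by
  induction l generalizing x with
  | nil => rfl
  | cons j l ih =>
    rw [List.mem_cons, not_or] at hq
    rw [spreadMap, ih hq.2, sendMap_of_ne hqh hq.1]

theorem gatherMap_congr {l : List (Node n)} {s : Set (Node n)} (hs : hub ∈ s)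
    (hl : ∀ j ∈ l, j ∈ s) {x y : Node n → ℕ} (h : ∀ q ∈ s, x q = y q) :
    ∀ q ∈ s, gatherMap hub Q l x q = gatherMap hub Q l y q := by
  induction l with
  | nil => exact h
  | cons j l ih =>
    have ih := ih fun i hi => hl i (List.mem_cons_of_mem _ hi)
    intro q hq
    have hj := ih j (hl j List.mem_cons_self)
    have hh := ih hub hs
    simp only [gatherMap, sendMap, hj, hh, Function.update_apply]
    split_ifs
    · rfl
    · rfl
    · exact ih q hq

theorem gatherMap_lt (hQ : 0 < Q) {l : List (Node n)} (hnd : l.Nodup) (hl : hub ∉ l) {D : ℕ}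
    {x : Node n → ℕ} (hx : x hub < D * Q ^ l.length) (hxl : ∀ j ∈ l, x j = 0) :
    gatherMap hub Q l x hub < D ∧ ∀ j ∈ l, gatherMap hub Q l x j < Q := by
  induction l generalizing D with
  | nil => simpa [gatherMap] using hx
  | cons j l ih =>
    rw [List.mem_cons, not_or] at hl
    rw [List.nodup_cons] at hnd
    rw [List.length_cons, pow_succ', ← mul_assoc] at hx
    obtain ⟨h1, h2⟩ := ih hnd.2 hl.2 hx fun i hi => hxl i (List.mem_cons_of_mem _ hi)
    have hj : gatherMap hub Q l x j = 0 := by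
      rw [gatherMap_of_notMem hnd.1 (Ne.symm hl.1), hxl j List.mem_cons_self]
    rw [gatherMap]
    refine ⟨?_, fun i hi => ?_⟩
    · rw [sendMap_snd]
      exact Nat.div_lt_of_lt_mul (by rwa [mul_comm])
    · rcases List.mem_cons.mp hi with rfl | hil
      · rw [sendMap_fst (Ne.symm hl.1), hj, zero_mul, zero_add]
        exact Nat.mod_lt _ hQ
      · rw [sendMap_of_ne (by rintro rfl; exact hnd.1 hil) (by rintro rfl; exact hl.2 hil)]
        exact h2 i hil

theorem spreadMap_lt {l : List (Node n)} (hnd : l.Nodup) (hl : hub ∉ l) {D : ℕ}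
    {x : Node n → ℕ} (hx : x hub < D) (hxl : ∀ j ∈ l, x j < Q) :
    spreadMap hub Q l x hub < D * Q ^ l.length ∧ ∀ j ∈ l, spreadMap hub Q l x j = 0 := by
  induction l generalizing D x with
  | nil => simpa [spreadMap] using hx
  | cons j l ih =>
    rw [List.mem_cons, not_or] at hl
    rw [List.nodup_cons] at hnd
    have hj := hxl j List.mem_cons_self
    have hne : ∀ i ∈ l, sendMap hub j Q x i = x i := fun i hi =>
      sendMap_of_ne (by rintro rfl; exact hl.2 hi) (by rintro rfl; exact hnd.1 hi) _ _
    have hhub : sendMap hub j Q x hub < D * Q := by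
      rw [sendMap_fst hl.1, Nat.mod_eq_of_lt hj]
      calc x hub * Q + x j < x hub * Q + Q := by omega
        _ = (x hub + 1) * Q := by ring
        _ ≤ D * Q := Nat.mul_le_mul_right _ hx
    obtain ⟨h1, h2⟩ := ih hnd.2 hl.2 hhub fun i hi => by
      rw [hne i hi]; exact hxl i (List.mem_cons_of_mem _ hi)
    rw [spreadMap]
    refine ⟨by rwa [List.length_cons, pow_succ', ← mul_assoc], fun i hi => ?_⟩
    rcases List.mem_cons.mp hi with rfl | hi
    · rw [spreadMap_of_notMem hnd.1 (Ne.symm hl.1), sendMap_snd]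
      exact Nat.div_eq_of_lt hj
    · exact h2 i hi

theorem Realizable.gather {l : List (Node n)} (hnd : l.Nodup) (hl : hub ∉ l)
    (hle : some e ∉ l) (hhe : hub ≠ some e) (hH : ∀ j ∈ l, s(hub, j) ∈ H) {d d' : Node n → ℕ}
    (hd : ∀ j ∈ l, d j = Q)
    (hd' : d' = fun q => if q ∈ l then 1 else if q = hub then d hub * Q ^ l.length else d q)
    {S} {b : Sym2 (Node n) → ℕ} (h : Realizable e H d' S b) :
    Realizable e H d (fun R ψ => S R (ψ ∘ gatherMap hub Q l))
      (fun h => (l.map fun j => if h = s(hub, j) then Q else 1).prod * b h) := by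
  induction l generalizing d with
  | nil =>
    have : d' = d := by
      rw [hd']
      funext q
      by_cases hq : q = hub
      · simp [hq]
      · simp [hq]
    subst this
    exact h.congr rfl fun _ => one_mul _
  | cons j l ih =>
    rw [List.mem_cons, not_or] at hl hle
    rw [List.nodup_cons] at hnd
    have h1 := ih hnd.2 hl.2 hle.2 (fun i hi => hH i (List.mem_cons_of_mem _ hi))
      (d := Function.update (Function.update d j 1) hub (d hub * Q))
      (fun i hi => by
        rw [Function.update_of_ne (by rintro rfl; exact hl.2 hi),
          Function.update_of_ne (by rintro rfl; exact hnd.1 hi), hd i (List.mem_cons_of_mem _ hi)])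
      (by
        rw [hd']
        funext q
        by_cases hqj : q = j
        · subst hqj
          simp [hnd.1, Ne.symm hl.1]
        · by_cases hqh : q = hub
          · subst hqh
            simp [hl, pow_succ', mul_assoc]
          · simp [hqj, hqh])
    have h2 := h1.send (A := j) (B := hub) (Ne.symm hle.1) hhe (Ne.symm hl.1)
      (by rw [Sym2.eq_swap]; exact hH j List.mem_cons_self) 1 Q
      (by rw [hd j List.mem_cons_self, one_mul]) rfl
    refine h2.congr rfl fun h' => ?_
    rw [List.map_cons, List.prod_cons, mul_assoc, Sym2.eq_swap]

theorem Realizable.spread {l : List (Node n)} (hnd : l.Nodup) (hl : hub ∉ l)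
    (hle : some e ∉ l) (hhe : hub ≠ some e) (hH : ∀ j ∈ l, s(hub, j) ∈ H) {d d' : Node n → ℕ}
    (hd : ∀ j ∈ l, d j = 1) {D : ℕ} (hD : d hub = D * Q ^ l.length)
    (hd' : d' = fun q => if q ∈ l then Q else if q = hub then D else d q)
    {S} {b : Sym2 (Node n) → ℕ} (h : Realizable e H d' S b) :
    Realizable e H d (fun R ψ => S R (ψ ∘ spreadMap hub Q l))
      (fun h => (l.map fun j => if h = s(hub, j) then Q else 1).prod * b h) := by
  induction l generalizing d' D S b with
  | nil =>
    have : d' = d := by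
      rw [hd']
      funext q
      by_cases hq : q = hub
      · simpa [hq] using hD.symm
      · simp [hq]
    subst this
    exact h.congr rfl fun _ => one_mul _
  | cons j l ih =>
    rw [List.mem_cons, not_or] at hl hle
    rw [List.nodup_cons] at hnd
    have h1 := h.send (A := hub) (B := j) hhe (Ne.symm hle.1) hl.1 (hH j List.mem_cons_self)
      (d := fun q => if q ∈ l then Q else if q = hub then D * Q else d q) D Q
      (by simp [hl.2])
      (by
        rw [hd']
        funext q
        by_cases hqj : q = j
        · subst hqj
          simp [hnd.1, Ne.symm hl.1, hd]
        · by_cases hqh : q = hub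
          · subst hqh
            simp [hl]
          · simp [hqj, hqh])
    have h2 := ih hnd.2 hl.2 hle.2 (fun i hi => hH i (List.mem_cons_of_mem _ hi))
      (fun i hi => hd i (List.mem_cons_of_mem _ hi)) (D := D * Q)
      (by rw [hD, List.length_cons, pow_succ', mul_assoc]) rfl h1
    refine h2.congr rfl fun h' => ?_
    rw [List.map_cons, List.prod_cons, mul_assoc, mul_left_comm]

/-- The protocol in which the hub collects the systems of the nodes in `l`, applies the
operators `K`, and returns one system to each of these nodes and one to the replacement node. -/
theorem realizable_collect {l : List (Node n)} (hQ : 0 < Q) (hnd : l.Nodup) (hl : hub ∉ l)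
    (hle : some e ∉ l) (hln : none ∉ l) (hhe : hub ≠ some e) (hhn : hub ≠ none)
    (hH : ∀ j ∈ l, s(hub, j) ∈ H) (hHn : s(hub, none) ∈ H)
    (K : Fin Q → Matrix (Fin (Q * Q ^ l.length * Q)) (Fin (Q * Q ^ l.length)) ℂ)
    (hK : ∑ o, (K o)ᴴ * K o = 1) :
    Realizable e H (fun _ => Q)
      (fun R ψ => ∀ i o : Fin Q, R (fun _ => Q) (applySend hub none Q (applyLocal hub (K o)
        (applyLocal none (Matrix.single (0 : Fin 1) i (1 : ℂ)) ψ ∘ gatherMap hub Q l))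
          ∘ spreadMap hub Q l))
      (fun h => (l.map fun j => if h = s(hub, j) then Q else 1).prod
        * ((if h = s(hub, none) then Q else 1)
        * ((l.map fun j => if h = s(hub, j) then Q else 1).prod * 1))) := by
  have hD0 : 0 < Q * Q ^ l.length := by positivity
  have h1 := (Realizable.halt (e := e) (H := H) fun _ : Node n => Q).spread
    (d := fun q => if q ∈ l then 1 else if q = hub then Q * Q ^ l.length else Q) (D := Q) (Q := Q)
    hnd hl hle hhe hH (fun j hj => by simp [hj]) (by simp [hl])
    (by funext q; split_ifs <;> simp_all)
  have h2 := h1.send (A := hub) (B := none) hhe (by simp) hhn hHn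
    (d := fun q => if q ∈ l then 1 else if q = hub then Q * Q ^ l.length * Q else
      if q = none then 1 else Q) (Q * Q ^ l.length) Q (by simp [hl])
    (by
      funext q
      by_cases hqn : q = none
      · subst hqn; simp [hln, Ne.symm hhn]
      · by_cases hqh : q = hub
        · subst hqh; simp [hl, hqn]
        · simp [hqn, hqh])
  have h3 := Realizable.localOp (p := hub) hhe hQ (k := Q * Q ^ l.length * Q) (by positivity)
    (d := fun q => if q ∈ l then 1 else if q = hub then Q * Q ^ l.length else
      if q = none then 1 else Q) (by simp [hl]) K hK
    (by
      convert h2 using 1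
      funext q
      by_cases hqh : q = hub
      · subst hqh; simp [hl]
      · simp [hqh])
  have h4 := h3.gather (d := Function.update (fun _ => Q) none 1) (hub := hub) (Q := Q) (l := l)
    hnd hl hle hhe hH
    (fun j hj => by rw [Function.update_of_ne (by rintro rfl; exact hln hj)])
    (by
      funext q
      by_cases hqn : q = none
      · subst hqn; simp [Ne.symm hhn]
      · by_cases hqh : q = hub
        · subst hqh; simp [hqn]
        · simp [hqn, hqh])
  have hK0 : ∑ i : Fin Q, (Matrix.single (0 : Fin 1) i (1 : ℂ))ᴴ * Matrix.single (0 : Fin 1) i (1 : ℂ)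
      = 1 := by
    simp only [Matrix.conjTranspose_single, Matrix.single_mul_single_same, star_one, mul_one]
    ext i j
    simp [Matrix.sum_apply, Matrix.single_apply, Matrix.one_apply, ite_and]
  have h5 := Realizable.localOp (d := fun _ => Q) (p := none) (D := Q) (k := 1) (by simp) hQ
    one_pos rfl (fun i : Fin Q => Matrix.single (0 : Fin 1) i (1 : ℂ)) hK0 h4
  exact h5

end Realizable

section Recovery

variable {R Y E F : Type*} [Fintype R] [Fintype Y] [Fintype F]
  [DecidableEq R] [DecidableEq E] [DecidableEq F]

/-- The Kraus operator that projects the system entangled with `E` on `o` and creates a new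
system entangled in the same way. -/
noncomputable def recoveryKraus (a : R → Y → E → F → ℂ) (c : ℂ) (o : E) : Matrix (Y × E) Y ℂ :=
  Matrix.of fun b y => c * ∑ r, ∑ f, a r b.1 b.2 f * star (a r y o f)

theorem recoveryKraus_apply_sum {a : R → Y → E → F → ℂ} {l : ℂ}
    (H : ∀ r r' o o' f f', ∑ y, star (a r y o f) * a r' y o' f'
      = if r = r' ∧ o = o' ∧ f = f' then l else 0) (c : ℂ) (o : E) (b : Y × E) (r : R) (o' : E)
    (f : F) :
    ∑ y, recoveryKraus a c o b y * a r y o' f = if o = o' then c * l * a r b.1 b.2 f else 0 := by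
  have h1 : ∀ y, recoveryKraus a c o b y * a r y o' f
      = ∑ r', ∑ f', c * a r' b.1 b.2 f' * (star (a r' y o f') * a r y o' f) := by
    intro y
    simp only [recoveryKraus, Matrix.of_apply, Finset.mul_sum, Finset.sum_mul]
    exact Finset.sum_congr rfl fun _ _ => Finset.sum_congr rfl fun _ _ => by ring
  simp_rw [h1]
  rw [Finset.sum_comm, Finset.sum_eq_single r]
  · rw [Finset.sum_comm, Finset.sum_eq_single f]
    · rw [← Finset.mul_sum, H]
      split_ifs <;> simp_all; ring
    · intro f' _ hf'
      rw [← Finset.mul_sum, H, if_neg (fun h => hf' h.2.2), mul_zero]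
    · simp
  · intro r' _ hr'
    rw [Finset.sum_comm]
    refine Finset.sum_eq_zero fun f' _ => ?_
    rw [← Finset.mul_sum, H, if_neg (fun h => hr' h.1), mul_zero]
  · simp

theorem sum_recoveryKraus [Fintype E] [DecidableEq Y] {a : R → Y → E → F → ℂ} {l : ℂ}
    (H : ∀ r r' o o' f f', ∑ y, star (a r y o f) * a r' y o' f'
      = if r = r' ∧ o = o' ∧ f = f' then l else 0)
    (H' : ∀ y y', ∑ r, ∑ o, ∑ f, star (a r y o f) * a r y' o f = if y = y' then l else 0)
    {c : ℂ} (hc : star c * c * (Fintype.card E * l * l) = 1) :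
    ∑ o, (recoveryKraus a c o)ᴴ * recoveryKraus a c o = 1 := by
  have h1 : ∀ o y y', ((recoveryKraus a c o)ᴴ * recoveryKraus a c o) y y'
      = star c * c * (Fintype.card E * l) * ∑ r, ∑ f, a r y o f * star (a r y' o f) := by
    intro o y y'
    set M : Matrix (R × F) (Y × E) ℂ := Matrix.of fun x b => a x.1 b.1 b.2 x.2 with hM
    set N : Matrix (R × F) Y ℂ := Matrix.of fun x y => a x.1 y o x.2 with hN
    have hK : recoveryKraus a c o = c • (Mᵀ * N.map star) := by
      ext b y
      simp [recoveryKraus, Matrix.mul_apply, hM, hN, Fintype.sum_prod_type]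
    have hMM : (Mᵀ)ᴴ * Mᵀ = (Fintype.card E * l) • (1 : Matrix (R × F) (R × F) ℂ) := by
      ext x x'
      rw [Matrix.mul_apply, Fintype.sum_prod_type, Finset.sum_comm]
      simp only [hM, Matrix.conjTranspose_apply, Matrix.transpose_apply, Matrix.of_apply, H]
      rw [Matrix.smul_apply, Matrix.one_apply]
      by_cases hx : x = x'
      · simp [hx]
      · have : ¬ (x.1 = x'.1 ∧ x.2 = x'.2) := fun h => hx (Prod.ext h.1 h.2)
        simp [hx, this]
    rw [hK, Matrix.conjTranspose_smul, Matrix.conjTranspose_mul, Matrix.smul_mul,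
      Matrix.mul_smul, Matrix.mul_assoc, ← Matrix.mul_assoc (Mᵀ)ᴴ, hMM, Matrix.smul_mul,
      Matrix.one_mul, Matrix.mul_smul]
    simp only [Matrix.smul_apply, smul_eq_mul, Matrix.mul_apply, Fintype.sum_prod_type,
      Matrix.conjTranspose_apply, Matrix.map_apply, hN, Matrix.of_apply, star_star]
    ring
  ext y y'
  rw [Matrix.sum_apply]
  simp_rw [h1]
  rw [← Finset.mul_sum, Finset.sum_comm]
  have h2 : ∑ r, ∑ o, ∑ f, a r y o f * star (a r y' o f) = if y' = y then l else 0 := by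
    rw [← H']
    exact Finset.sum_congr rfl fun _ _ => Finset.sum_congr rfl fun _ _ =>
      Finset.sum_congr rfl fun _ _ => mul_comm _ _
  rw [h2, Matrix.one_apply]
  by_cases hy : y = y'
  · rw [if_pos hy.symm, if_pos hy, ← hc]; ring
  · rw [if_neg (Ne.symm hy), if_neg hy, mul_zero]

end Recovery

section UpperBound

variable {n Q : ℕ} {T : Finset (Fin n)} {e j₁ : Fin n}

/-- The helper nodes other than the hub. -/
noncomputable def helperList (T : Finset (Fin n)) (j₁ : Fin n) : List (Node n) :=
  (T.erase j₁).toList.map some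

theorem some_mem_helperList {i : Fin n} : some i ∈ helperList T j₁ ↔ i ∈ T ∧ i ≠ j₁ := by
  simp [helperList, and_comm]

theorem none_notMem_helperList : none ∉ helperList T j₁ := by
  simp [helperList]

theorem nodup_helperList : (helperList T j₁).Nodup :=
  (Finset.nodup_toList _).map (Option.some_injective _)

theorem length_helperList (hj₁ : j₁ ∈ T) : (helperList T j₁).length = T.card - 1 := by
  simp [helperList, hj₁]

/-- The labels of the nodes in which the hub holds the label `b` and the others hold `0`. -/
def hubLabel (hub : Node n) (b : ℕ) : Node n → ℕ := Function.update 0 hub b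

/-- The correspondence between the labels of the hub after collecting the systems of the
helpers, and the configurations of the helpers. -/
theorem exists_hubEquiv (hQ : 0 < Q) (hj₁ : j₁ ∈ T) :
    ∃ E : Fin (Q * Q ^ (helperList T j₁).length) ≃ Fin Q × HelperConfig Q T j₁,
    ∀ b : Fin (Q * Q ^ (helperList T j₁).length),
      gatherMap (some j₁) Q (helperList T j₁) (hubLabel (some j₁) b) (some j₁) = (E b).1 ∧
      ∀ i : {i : Fin n // i ∈ T ∧ i ≠ j₁},
        gatherMap (some j₁) Q (helperList T j₁) (hubLabel (some j₁) b) (some i) = (E b).2 i := by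
  have hhub : (some j₁ : Node n) ∉ helperList T j₁ := fun h => (some_mem_helperList.mp h).2 rfl
  have hlt : ∀ b : Fin (Q * Q ^ (helperList T j₁).length), _ := fun b =>
    gatherMap_lt (hub := some j₁) (D := Q) (x := hubLabel (some j₁) b) hQ nodup_helperList hhub
      (by simp [hubLabel]) (fun j hj => by
        have : j ≠ some j₁ := by rintro rfl; exact hhub hj
        simp [hubLabel, this])
  let f : Fin (Q * Q ^ (helperList T j₁).length) → Fin Q × HelperConfig Q T j₁ := fun b =>
    (⟨_, (hlt b).1⟩, fun i => ⟨_, (hlt b).2 (some i) (some_mem_helperList.mpr i.2)⟩)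
  have hinj : Function.Injective f := by
    intro b b' hbb
    have h1 : gatherMap (some j₁) Q (helperList T j₁) (hubLabel (some j₁) b)
        = gatherMap (some j₁) Q (helperList T j₁) (hubLabel (some j₁) b') := by
      funext q
      by_cases hq : q = some j₁
      · subst hq
        exact congrArg (fun p => (p.1 : ℕ)) hbb
      by_cases hql : q ∈ helperList T j₁
      · cases q with
        | none => exact absurd hql none_notMem_helperList
        | some i =>
          exact congrArg (fun p => (p.2 ⟨i, some_mem_helperList.mp hql⟩ : ℕ)) hbb
      · rw [gatherMap_of_notMem hql hq, gatherMap_of_notMem hql hq]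
        simp [hubLabel, hq]
    have h2 := congrArg (spreadMap (some j₁) Q (helperList T j₁)) h1
    rw [spreadMap_gatherMap hQ hhub, spreadMap_gatherMap hQ hhub] at h2
    have h3 := congrFun h2 (some j₁)
    simp only [hubLabel, Function.update_self] at h3
    exact Fin.ext h3
  have hbij : Function.Bijective f := by
    rw [Fintype.bijective_iff_injective_and_card]
    refine ⟨hinj, ?_⟩
    rw [Fintype.card_prod, Fintype.card_fin, Fintype.card_fin, card_helperConfig hj₁,
      length_helperList hj₁]
  exact ⟨Equiv.ofBijective f hbij, fun b => ⟨rfl, fun i => rfl⟩⟩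

theorem applyLocal_discard (φ : QuditVec n Q) (i : Fin Q) :
    applyLocal none (Matrix.single (0 : Fin 1) i (1 : ℂ)) (initialState φ)
      = if (i : ℕ) = 0 then initialState φ else 0 := by
  funext x
  have h0 : ∀ k : ℕ, initialState φ (Function.update x none k)
      = if k = 0 then toAmp φ (fun i => x (some i)) else 0 := by
    intro k
    simp [initialState]
  have hfin : ∀ h : x none < 1, (⟨x none, h⟩ : Fin 1) = 0 := fun h => Subsingleton.elim _ _
  simp only [applyLocal, h0, hfin, Nat.lt_one_iff]
  split_ifs with h1 h2 h2
  · rw [Finset.sum_eq_single i]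
    · simp [h2, initialState, h1]
    · intro b _ hb
      simp [Ne.symm hb]
    · simp
  · refine Finset.sum_eq_zero fun b _ => ?_
    by_cases hb : i = b
    · subst hb; simp [h2]
    · simp [hb]
  · simp [initialState, h1]
  · rfl

theorem toAmp_eq {φ : QuditVec n Q} {x : Fin n → ℕ} {y : Fin n → Fin Q} (h : ∀ i, x i = y i) :
    toAmp φ x = φ y := by
  rw [← toAmp_val φ y]
  congr 1
  exact funext h

theorem glue_eq_of_forall {x : Fin n → ℕ} {α β : Fin Q}
    {f : IdleConfig Q T e} {g : HelperConfig Q T j₁} (hα : x j₁ = α) (hβ : x e = β)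
    (hf : ∀ i : {i : Fin n // i ∉ T ∧ i ≠ e}, x i = f i)
    (hg : ∀ i : {i : Fin n // i ∈ T ∧ i ≠ j₁}, x i = g i) (i : Fin n) :
    x i = (glue T e j₁ α β f g i : Fin Q) := by
  unfold glue
  split_ifs with h1 h2 h3
  · rw [h1, hβ]
  · rw [h2, hα]
  · exact hg ⟨i, h3, h2⟩
  · exact hf ⟨i, h3, h1⟩

/-- The effect of the recovery protocol on a state in the span of the family `a`. -/
theorem recovery_eq_correctedState (hQ : 0 < Q) (heT : e ∉ T) (hj₁ : j₁ ∈ T)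
    {φ : QuditVec n Q} {κ : Fin Q → Matrix ((Fin Q × HelperConfig Q T j₁) × Fin Q)
      (Fin Q × HelperConfig Q T j₁) ℂ} {c : ℂ}
    (hκ : ∀ o b o' f, ∑ y, κ o b y * φ (glue T e j₁ y.1 o' f y.2)
      = if o = o' then c * φ (glue T e j₁ b.1.1 b.2 f b.1.2) else 0)
    {l : List (Node n)} (hl : l = helperList T j₁)
    {E : Fin (Q * Q ^ l.length) ≃ Fin Q × HelperConfig Q T j₁}
    (hE : ∀ b : Fin (Q * Q ^ l.length),
      gatherMap (some j₁) Q (l) (hubLabel (some j₁) b) (some j₁) = (E b).1 ∧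
      ∀ i : {i : Fin n // i ∈ T ∧ i ≠ j₁},
        gatherMap (some j₁) Q (l) (hubLabel (some j₁) b) (some i) = (E b).2 i)
    (o : Fin Q) {x : Node n → ℕ} (hx : ∀ q, x q < Q) :
    (applySend (some j₁) none Q (applyLocal (some j₁)
      ((κ o).submatrix (finProdFinEquiv.symm.trans (E.prodCongr (Equiv.refl _))) E)
      (initialState φ ∘ gatherMap (some j₁) Q (l)))
        ∘ spreadMap (some j₁) Q (l)) x
      = correctedState e φ (c • Pi.single o 1) x := by
  have hhub : (some j₁ : Node n) ∉ l := fun h =>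
    (some_mem_helperList.mp (hl ▸ h)).2 rfl
  have hnl : (none : Node n) ∉ l := hl ▸ none_notMem_helperList
  have hmem : ∀ i : {i : Fin n // i ∈ T ∧ i ≠ j₁}, (some (i : Fin n) : Node n) ∈ l := fun i =>
    hl ▸ some_mem_helperList.mpr i.2
  set w := spreadMap (some j₁) Q l x with hw
  have hwx : gatherMap (some j₁) Q l w = x := gatherMap_spreadMap hQ hhub x
  obtain ⟨hwhub, hwl⟩ : w (some j₁) < Q * Q ^ l.length ∧ ∀ j ∈ l, w j = 0 := spreadMap_lt (Q := Q) (D := Q) (x := x) (hl ▸ nodup_helperList) hhub (hx _)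
    (fun j _ => hx j)
  have hwo : ∀ q, q ∉ l → q ≠ some j₁ → w q = x q := fun q h h' => spreadMap_of_notMem h h' x
  -- labels at the time of the measurement
  set u := sendMap (some j₁) none Q w with hu
  have hjn : (some j₁ : Node n) ≠ none := by simp
  have hwn : w none = x none := hwo none hnl hjn.symm
  have huhub : u (some j₁) = w (some j₁) * Q + x none := by
    rw [hu, sendMap_fst hjn, hwn, Nat.mod_eq_of_lt (hx none)]
  have hun : u none = 0 := by
    rw [hu, sendMap_snd, hwn, Nat.div_eq_of_lt (hx none)]
  have huo : ∀ q, q ≠ some j₁ → q ≠ none → u q = w q := fun q h h' => sendMap_of_ne h h' _ _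
  have hb : u (some j₁) = finProdFinEquiv
      ((⟨w (some j₁), hwhub⟩ : Fin (Q * Q ^ l.length)), (⟨x none, hx none⟩ : Fin Q)) := by
    rw [huhub, finProdFinEquiv_apply_val]
    simp only
    ring
  have hlt : u (some j₁) < Q * Q ^ l.length * Q := by rw [hb]; exact Fin.is_lt _
  have hbf : (⟨u (some j₁), hlt⟩ : Fin (Q * Q ^ l.length * Q)) = finProdFinEquiv
      ((⟨w (some j₁), hwhub⟩ : Fin (Q * Q ^ l.length)), (⟨x none, hx none⟩ : Fin Q)) := Fin.ext hb
  set f : IdleConfig Q T e := fun i => ⟨x (some i), hx _⟩ with hf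
  have hset : ∀ (y : Node n → ℕ) (b : ℕ), (∀ q ∈ l, y q = 0) → y (some j₁) = b →
      ∀ q, (q ∈ l ∨ q = some j₁) → gatherMap (some j₁) Q l y q
        = gatherMap (some j₁) Q l (hubLabel (some j₁) b) q := by
    intro y b hy hyb q hq
    refine gatherMap_congr (s := {q | q ∈ l ∨ q = some j₁}) (Or.inr rfl) (fun _ h => Or.inl h)
      ?_ q hq
    rintro q (hq | rfl)
    · have : q ≠ some j₁ := by rintro rfl; exact hhub hq
      rw [hy q hq]; simp [hubLabel, this]
    · simp [hyb, hubLabel]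
  have hEw : (E ⟨w (some j₁), hwhub⟩) = (⟨x (some j₁), hx _⟩, fun i => ⟨x (some i), hx _⟩) := by
    obtain ⟨h1, h2⟩ := hE ⟨w (some j₁), hwhub⟩
    refine Prod.ext (Fin.ext ?_) (funext fun i => Fin.ext ?_)
    · rw [← h1, ← hset w _ hwl rfl _ (Or.inr rfl), hwx]
    · rw [← h2 i, ← hset w _ hwl rfl _ (Or.inl (hmem i)), hwx]
  have hterm : ∀ b : Fin (Q * Q ^ l.length),
      initialState φ (gatherMap (some j₁) Q l (Function.update u (some j₁) b))
        = φ (glue T e j₁ (E b).1 ⟨x (some e), hx _⟩ f (E b).2) := by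
    intro b
    obtain ⟨h1, h2⟩ := hE b
    have hz : ∀ q ∈ l, Function.update u (some j₁) (b : ℕ) q = 0 := by
      intro q hq
      have hq1 : q ≠ some j₁ := by rintro rfl; exact hhub hq
      have hq2 : q ≠ none := by rintro rfl; exact hnl hq
      rw [Function.update_of_ne hq1, huo q hq1 hq2, hwl q hq]
    have hS := hset (Function.update u (some j₁) (b : ℕ)) b hz (by simp)
    have hout : ∀ i, i ∉ T →
        gatherMap (some j₁) Q l (Function.update u (some j₁) b) (some i) = x (some i) := by
      intro i hi
      have hq1 : (some i : Node n) ≠ some j₁ := by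
        intro h; exact hi ((Option.some_injective _ h) ▸ hj₁)
      have hq2 : (some i : Node n) ∉ l := fun h => hi (some_mem_helperList.mp (hl ▸ h)).1
      rw [gatherMap_of_notMem hq2 hq1, Function.update_of_ne hq1, huo _ hq1 (by simp),
        hwo _ hq2 hq1]
    have hn : gatherMap (some j₁) Q l (Function.update u (some j₁) b) none = 0 := by
      rw [gatherMap_of_notMem hnl hjn.symm, Function.update_of_ne hjn.symm, hun]
    unfold initialState
    rw [if_pos hn]
    refine toAmp_eq (glue_eq_of_forall ?_ ?_ ?_ ?_)
    · rw [hS _ (Or.inr rfl), h1]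
    · exact hout e heT
    · exact fun i => hout i i.2.1
    · intro i
      rw [hS _ (Or.inl (hmem i)), h2 i]
  have hLHS : (applySend (some j₁) none Q (applyLocal (some j₁)
      ((κ o).submatrix (finProdFinEquiv.symm.trans (E.prodCongr (Equiv.refl _))) E)
      (initialState φ ∘ gatherMap (some j₁) Q l)) ∘ spreadMap (some j₁) Q l) x
      = ∑ b, κ o (E ⟨w (some j₁), hwhub⟩, ⟨x none, hx none⟩) (E b)
        * φ (glue T e j₁ (E b).1 ⟨x (some e), hx _⟩ f (E b).2) := by
    rw [Function.comp_apply, applySend_apply, ← hw, ← hu, applyLocal, dif_pos hlt]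
    refine Finset.sum_congr rfl fun b _ => ?_
    rw [Function.comp_apply, hterm, Matrix.submatrix_apply, hbf]
    simp
  rw [hLHS, Equiv.sum_comp E (fun y => κ o (E ⟨w (some j₁), hwhub⟩, ⟨x none, hx none⟩) y
    * φ (glue T e j₁ y.1 ⟨x (some e), hx _⟩ f y.2)), hκ, hEw]
  have hRHS : toAmp φ (Function.update (fun i => x (some i)) e (x none))
      = φ (glue T e j₁ ⟨x (some j₁), hx _⟩ ⟨x none, hx _⟩ f fun i => ⟨x (some i), hx _⟩) := by
    refine toAmp_eq (glue_eq_of_forall ?_ ?_ ?_ ?_)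
    · rw [Function.update_of_ne (by rintro rfl; exact heT hj₁)]
    · simp
    · intro i; rw [Function.update_of_ne i.2.2]
    · intro i
      rw [Function.update_of_ne (by rintro h; exact heT (h ▸ i.2.1))]
  rw [correctedState, dif_pos (hx (some e)), hRHS]
  simp only [Pi.smul_apply, Pi.single_apply, smul_eq_mul, eq_comm (a := o)]
  split_ifs
  · ring
  · simp

theorem correctedState_eq_zero_of_le {φ : QuditVec n Q} {ε : Fin Q → ℂ} {x : Node n → ℕ}
    (hx : ∃ q, Q ≤ x q) : correctedState e φ ε x = 0 := by
  obtain ⟨q, hq⟩ := hx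
  unfold correctedState toAmp
  split_ifs with h1 h2
  · exfalso
    cases q with
    | none => have := h2 e; simp at this; omega
    | some i =>
      by_cases hi : i = e
      · subst hi; omega
      · have := h2 i; simp [hi] at this; omega
  · simp
  · rfl

theorem prod_map_edge (hub h : Node n) (l : List (Node n)) (hnd : l.Nodup) (Q : ℕ) :
    (l.map fun j => if s(hub, h) = s(hub, j) then Q else 1).prod = if h ∈ l then Q else 1 := by
  induction l with
  | nil => simp
  | cons j l ih =>
    rw [List.nodup_cons] at hnd
    rw [List.map_cons, List.prod_cons, ih hnd.2]
    by_cases hj : h = j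
    · subst hj; simp [hnd.1]
    · have : s(hub, h) ≠ s(hub, j) := by
        intro h'
        exact hj (Sym2.congr_right.mp h')
      simp [hj, this]

theorem exists_protocol {t : ℕ} (hQ : 2 ≤ Q) (ht : 1 < t) (htn : t < n) (hn : n ≤ 2 * t)
    {C : Submodule ℂ (QuditVec n Q)} (hC : IsQMDS C (2 * t - n)) (heT : e ∉ T)
    (hT : T.card = t) (hj₁ : j₁ ∈ T) :
    ∃ P : Protocol e (starAtHelper T j₁) (fun _ => Q), CorrectsErasure C e P ∧
      P.beta s(some j₁, none) = Q ∧
      ∀ j ∈ T, j ≠ j₁ → P.beta s(some j₁, some j) = Q ^ 2 := by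
  have hQ0 : 0 < Q := by omega
  obtain ⟨a, -, hspan, -, htens⟩ := hC.exists_tensor hQ ht htn hn heT hT
  obtain ⟨l, μ, ν, hl, -, -, H1, -, -, H4⟩ := htens j₁ hj₁
  obtain ⟨E, hE⟩ := exists_hubEquiv (n := n) hQ0 hj₁
  set a' : Fin (Q ^ (2 * t - n)) → Fin Q × HelperConfig Q T j₁ → Fin Q → IdleConfig Q T e → ℂ :=
    fun r y o f => a r (glue T e j₁ y.1 o f y.2) with ha'
  have HA : ∀ r r' o o' f f', ∑ y, star (a' r y o f) * a' r' y o' f'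
      = if r = r' ∧ o = o' ∧ f = f' then (l : ℂ) else 0 := by
    intro r r' o o' f f'
    simp only [ha', Fintype.sum_prod_type, H4]
  have HB : ∀ y y', ∑ r, ∑ o, ∑ f, star (a' r y o f) * a' r y' o f
      = if y = y' then (l : ℂ) else 0 := by
    rintro ⟨α, g⟩ ⟨α', g'⟩
    simp only [ha', H1, Prod.mk.injEq]
  set c : ℂ := ((1 / (l * Real.sqrt Q) : ℝ) : ℂ) with hc
  have hcc : star c * c * (Fintype.card (Fin Q) * (l : ℂ) * l) = 1 := by
    have h1 : star c = c := Complex.conj_ofReal _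
    have h2 : (1 / (l * Real.sqrt Q)) * (1 / (l * Real.sqrt Q)) * (Q * l * l) = 1 := by
      have hs : Real.sqrt Q * Real.sqrt Q = Q := Real.mul_self_sqrt (by positivity)
      have hs0 : Real.sqrt Q ≠ 0 := (Real.sqrt_pos.mpr (by exact_mod_cast hQ0)).ne'
      field_simp
      rw [sq, hs]
    rw [h1, Fintype.card_fin, hc]
    exact_mod_cast h2
  set κ := recoveryKraus a' c with hκdef
  set idx := finProdFinEquiv.symm.trans (E.prodCongr (Equiv.refl (Fin Q))) with hidx
  have hK : ∑ o, ((κ o).submatrix idx E)ᴴ * (κ o).submatrix idx E = 1 := by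
    have h1 : ∀ o, ((κ o).submatrix idx E)ᴴ * (κ o).submatrix idx E
        = ((κ o)ᴴ * κ o).submatrix E E := by
      intro o
      rw [Matrix.conjTranspose_submatrix, Matrix.submatrix_mul_equiv]
    simp_rw [h1]
    have h2 := congrArg (fun M => Matrix.submatrix M E E) (sum_recoveryKraus HA HB hcc)
    simp only [Matrix.submatrix_one_equiv] at h2
    rw [← h2]
    ext i j
    simp [Matrix.sum_apply, hκdef]
  have hhub : (some j₁ : Node n) ∉ helperList T j₁ := fun h => (some_mem_helperList.mp h).2 rfl
  obtain ⟨P, hP, hbeta⟩ := realizable_collect (e := e) (H := starAtHelper T j₁)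
    (hub := some j₁) (l := helperList T j₁) hQ0 nodup_helperList hhub
    (fun h => heT (some_mem_helperList.mp h).1) none_notMem_helperList
    (fun h => heT (Option.some_injective _ h ▸ hj₁)) (by simp)
    (fun j hj => by
      cases j with
      | none => exact absurd hj none_notMem_helperList
      | some i =>
        obtain ⟨hi, hij⟩ := some_mem_helperList.mp hj
        exact Finset.mem_insert_of_mem (Finset.mem_image_of_mem _ (Finset.mem_erase.mpr ⟨hij, hi⟩)))
    (Finset.mem_insert_self _ _) _ hK
  refine ⟨P, fun φ hφ => ?_, ?_, fun j hj hjj => ?_⟩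
  · have hsupp := (hP _ _).mp (P.alwaysEnds_supportedIn (supportedIn_initialState hQ0 φ))
    rw [hP]
    intro i o
    refine ⟨rfl, ?_⟩
    have hsupp := hsupp i o
    rw [applyLocal_discard] at hsupp ⊢
    split_ifs at hsupp ⊢ with hi
    · refine ⟨(c * l) • Pi.single o 1, ?_⟩
      have hκφ : ∀ o b o' f, ∑ y, κ o b y * φ (glue T e j₁ y.1 o' f y.2)
          = if o = o' then (c * l) * φ (glue T e j₁ b.1.1 b.2 f b.1.2) else 0 := by
        intro o b o' f
        obtain ⟨w, rfl⟩ := hspan φ hφ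
        simp only [Finset.sum_apply, Pi.smul_apply, smul_eq_mul, Finset.mul_sum]
        rw [Finset.sum_comm]
        have h1 : ∀ r, ∑ y, κ o b y * (w r * a r (glue T e j₁ y.1 o' f y.2))
            = if o = o' then c * l * (w r * a r (glue T e j₁ b.1.1 b.2 f b.1.2)) else 0 := by
          intro r
          have h2 := recoveryKraus_apply_sum HA c o b r o' f
          simp_rw [mul_left_comm _ (w r), ← Finset.mul_sum]
          rw [h2]
          split_ifs
          · ring
          · simp
        simp_rw [h1]
        split_ifs <;> simp
      funext x
      by_cases hx : ∀ q, x q < Q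
      · exact recovery_eq_correctedState hQ0 heT hj₁ hκφ rfl hE o hx
      · push Not at hx
        rw [correctedState_eq_zero_of_le hx]
        exact hsupp x hx
    · refine ⟨0, ?_⟩
      funext x
      simp [applySend, applyLocal, correctedState]
  · rw [hbeta]
    beta_reduce
    rw [prod_map_edge _ _ _ nodup_helperList, if_neg none_notMem_helperList]
    simp
  · rw [hbeta]
    beta_reduce
    rw [prod_map_edge _ _ _ nodup_helperList,
      if_pos (some_mem_helperList.mpr ⟨hj, hjj⟩), if_neg (by simp)]
    ring

end UpperBound

theorem sum_starAtHelper {n : ℕ} (T : Finset (Fin n)) (j₁ : Fin n) (f : Sym2 (Node n) → ℝ) :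
    ∑ h ∈ starAtHelper T j₁, f h
      = f s(some j₁, none) + ∑ j ∈ T.erase j₁, f s(some j₁, some j) := by
  rw [starAtHelper, Finset.sum_insert, Finset.sum_image]
  · intro i _ j _ hij
    exact Option.some_injective _ (Sym2.congr_right.mp hij)
  · simp

theorem mainTheorem2 (n t Q : ℕ) (hQ : 2 ≤ Q) (ht : 1 < t) (htn : t < n) (hn : n ≤ 2 * t)
    (C : Submodule ℂ (QuditVec n Q)) (hC : IsQMDS C (2 * t - n))
    (e : Fin n) (T : Finset (Fin n)) (heT : e ∉ T) (hT : T.card = t)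
    (j₁ : Fin n) (hj₁ : j₁ ∈ T) :
    IsEntanglementCost C e (starAtHelper T j₁) (2 * (t : ℝ) - 1) := by
  have hQ1 : (1 : ℝ) < Q := by exact_mod_cast hQ
  have hlog1 : Real.logb Q Q = 1 := Real.logb_self_eq_one hQ1
  have hlog2 : Real.logb Q ((Q : ℝ) ^ 2) = 2 := by
    rw [Real.logb_pow, hlog1]; norm_num
  have hsum : (1 : ℝ) + ∑ _j ∈ T.erase j₁, (2 : ℝ) = 2 * t - 1 := by
    rw [Finset.sum_const, Finset.card_erase_of_mem hj₁, hT, nsmul_eq_mul,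
      Nat.cast_sub (by omega)]
    push_cast
    ring
  constructor
  · obtain ⟨P, hP, h1, h2⟩ := exists_protocol hQ ht htn hn hC heT hT hj₁
    refine ⟨P, hP, ?_⟩
    rw [sum_starAtHelper, h1, hlog1, ← hsum]
    congr 1
    refine Finset.sum_congr rfl fun j hj => ?_
    rw [h2 j (Finset.mem_of_mem_erase hj) (Finset.ne_of_mem_erase hj), Nat.cast_pow, hlog2]
  · rintro w ⟨P, hP, rfl⟩
    rw [sum_starAtHelper, ← hsum]
    refine add_le_add ?_ (Finset.sum_le_sum fun j hj => ?_)
    · rw [← hlog1]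
      refine Real.logb_le_logb_of_le hQ1 (by positivity) ?_
      exact_mod_cast le_beta_replacement hQ ht htn hn hC heT hT hj₁ hP
    · rw [← hlog2]
      refine Real.logb_le_logb_of_le hQ1 (by positivity) ?_
      exact_mod_cast sq_le_beta_helper hQ ht htn hn hC heT hT hj₁ hP
        (Finset.mem_of_mem_erase hj) (Finset.ne_of_mem_erase hj)
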